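/- Let $(M,d)$ be a connected, locally compact metric space and $Z\subset M$ a nonempty, closed, proper subset such that $M\setminus Z$ is a $C^k$ manifold, $k\ge 2$, of dimension $n\ge 1$, with a Riemannian metric (of class $C^1$) from which the restriction of $d$ to $M\setminus Z$ comes, i.e. the length with respect to $d$ of every $C^1$ curve in $M\setminus Z$ is its Riemannian length. Let $f\colon M\to[0,\infty)$ be continuous with $f^{-1}(0)=Z$ and of class $C^2$ on $M\setminus Z$. Call $(\rho,U,\Psi)$ a KŁ triple if $\rho>0$, $U\subset M$, and $\Psi\colon[0,\rho)\to[0,\infty)$ is continuous, vanishes exactly at $0$, is $C^1$ on $(0,\rho)$ with $\Psi'>0$ there, and $|\nabla_x(\Psi\circ f)|\ge 1$ for all $x\in f^{-1}((0,\rho))\cap U$. The function $f$ is a KŁ function if every $p\in\partial Z$ has an open neighborhood $U$ belonging to a KŁ triple $(\rho,U,\Psi)$; it is a global KŁ function with associated triple $(\rho,U,\Psi)$ if this is a KŁ triple and $U$ is a neighborhood of $\partial Z$. For every $x\in M\setminus Z$ the Cauchy problem $\alpha'=-\nabla f(\alpha)$, $\alpha(0)=x$, has a maximal solution $\alpha_x\colon(\mu_x^-,\mu_x^+)\to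 M\setminus Z$. If $f$ is a KŁ function, there is an open neighborhood $V$ of $Z$ in $M$ such that: 1. for every $x\in V\setminus Z$, $\alpha_x(t)$ converges in $M$, as $t\to\mu_x^+$, to a point of $\partial Z$; 2. the map $R\colon V\to Z$ with $R(x)=\lim_{t\to\mu_x^+}\alpha_x(t)$ for $x\in V\setminus Z$ and $R(x)=x$ for $x\in Z$ is continuous, hence a retraction; 3. for every $x\in V\setminus Z$ the length of $\alpha_x|_{[0,\mu_x^+)}$ is positive and finite, and it is a continuous function $V\setminus Z\to(0,\infty)$ of $x$. If moreover $f$ is a global KŁ function with associated triple $(\rho,U,\Psi)$, then $V$ can be chosen with $V\subset f^{-1}([0,\rho))$. -/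

import Mathlib

open Set Filter MeasureTheory Bundle
open scoped Manifold ContDiff Topology ENNReal

noncomputable section

namespace KLFlow

section Riemannian

variable {n : ℕ} {N : Type*} [TopologicalSpace N] [ChartedSpace (EuclideanSpace ℝ (Fin n)) N]
  [RiemannianBundle (fun x : N ↦ TangentSpace (𝓡 n) x)]

theorem completeSpace_tangentSpace (x : N) : CompleteSpace (TangentSpace (𝓡 n) x) :=
  haveI : FiniteDimensional ℝ (TangentSpace (𝓡 n) x) :=
    inferInstanceAs (FiniteDimensional ℝ (EuclideanSpace ℝ (Fin n)))
  FiniteDimensional.complete ℝ _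

/-- The Riemannian gradient of `g : N → ℝ` at `x`: the tangent vector representing the differential
of `g` at `x` with respect to the inner product of the tangent space. -/
def grad (g : N → ℝ) (x : N) : TangentSpace (𝓡 n) x :=
  haveI := completeSpace_tangentSpace (n := n) x
  (InnerProductSpace.toDual ℝ (TangentSpace (𝓡 n) x)).symm (mfderiv (𝓡 n) 𝓘(ℝ, ℝ) g x)

theorem inner_grad (g : N → ℝ) (x : N) (v : TangentSpace (𝓡 n) x) :
    inner ℝ (grad g x) v = (mfderiv (𝓡 n) 𝓘(ℝ, ℝ) g x v : ℝ) := by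
  have := completeSpace_tangentSpace (n := n) x
  exact InnerProductSpace.toDual_symm_apply

/-- `α`, restricted to the open interval `J` around `0`, is a maximal solution of the Cauchy problem
`α' = -∇ g (α)`, `α 0 = x`: it cannot be extended to a solution on a larger open interval. The
values of `α` outside `J` are irrelevant. -/
structure IsMaximalTrajectory (g : N → ℝ) (x : N) (α : ℝ → N) (J : Set ℝ) : Prop where
  isOpen : IsOpen J
  ordConnected : J.OrdConnected
  zero_mem : (0 : ℝ) ∈ J
  initial : α 0 = x
  integralCurve : IsMIntegralCurveOn (I := 𝓡 n) α (fun y ↦ -grad g y) J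
  maximal : ∀ (β : ℝ → N) (J' : Set ℝ), IsOpen J' → J'.OrdConnected → J ⊆ J' →
    IsMIntegralCurveOn (I := 𝓡 n) β (fun y ↦ -grad g y) J' → EqOn α β J → J' = J

/-- The Riemannian length of the forward part of a curve `α` defined on the interval `J ∋ 0`:
the integral of the speed over all `t ∈ J` with `t ≥ 0`. -/
def forwardLength (α : ℝ → N) (J : Set ℝ) : ℝ≥0∞ :=
  ∫⁻ t in J ∩ Ici 0, ‖mfderiv 𝓘(ℝ, ℝ) (𝓡 n) α t 1‖ₑ

end Riemannian

section Relative

variable {n : ℕ} {M : Type*} [MetricSpace M]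

/-- The conditions on a pair `(M, Z)`, with `M` a connected locally compact metric space and `M ∖ Z`
a Riemannian manifold of dimension `n`, to be a relative manifold. The last one says that the
restriction of the metric of `M` to `M ∖ Z` comes from the Riemannian metric: the length of every
`C¹` curve in `M ∖ Z` with respect to the distance of `M` (the supremum of the lengths of inscribed
polygons) is its Riemannian length. -/
structure IsRelativeManifold (n : ℕ) (Z : Set M)
    [ChartedSpace (EuclideanSpace ℝ (Fin n)) ↥Zᶜ]
    [RiemannianBundle (fun x : ↥Zᶜ ↦ TangentSpace (𝓡 n) x)] : Prop where
  one_le_dim : 1 ≤ n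
  isClosed : IsClosed Z
  nonempty : Z.Nonempty
  ne_univ : Z ≠ univ
  length_eq : ∀ (γ : ℝ → ↥Zᶜ) (a b : ℝ), a ≤ b → ContMDiffOn 𝓘(ℝ, ℝ) (𝓡 n) 1 γ (Icc a b) →
    eVariationOn (fun t ↦ (γ t : M)) (Icc a b) = Manifold.pathELength (𝓡 n) γ a b

/-- `f` is a relative function `(M, Z) → ([0, ∞), {0})` of class `C^l`: continuous on `M`,
vanishing exactly on `Z`, and of class `C^l` on `M ∖ Z`. -/
structure IsRelativeFunction (n : ℕ) (l : ℕ∞ω) (Z : Set M)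
    [ChartedSpace (EuclideanSpace ℝ (Fin n)) ↥Zᶜ] (f : M → ℝ) : Prop where
  nonneg : ∀ x, 0 ≤ f x
  eq_zero_iff : ∀ x, f x = 0 ↔ x ∈ Z
  continuous : Continuous f
  contMDiff : ContMDiff (𝓡 n) 𝓘(ℝ, ℝ) l (fun x : ↥Zᶜ ↦ f x)

/-- The requirements on a triple `(ρ, U, Ψ)` in the Kurdyka–Łojasiewicz condition (apart from `U`
being a neighbourhood): `Ψ : ([0, ρ), {0}) → ([0, ∞), {0})` is a `C¹` relative function, i.e.
continuous on `[0, ρ)`, zero exactly at `0` and `C¹` on `(0, ρ)`, with `Ψ' > 0` on `(0, ρ)`, and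
`|∇ (Ψ ∘ f)| ≥ 1` on `f⁻¹((0, ρ)) ∩ U`. -/
structure IsKLTriple (n : ℕ) (Z : Set M)
    [ChartedSpace (EuclideanSpace ℝ (Fin n)) ↥Zᶜ]
    [RiemannianBundle (fun x : ↥Zᶜ ↦ TangentSpace (𝓡 n) x)]
    (f : M → ℝ) (ρ : ℝ) (U : Set M) (Ψ : ℝ → ℝ) : Prop where
  rho_pos : 0 < ρ
  psi_zero : Ψ 0 = 0
  psi_pos : ∀ t ∈ Ioo 0 ρ, 0 < Ψ t
  psi_continuousOn : ContinuousOn Ψ (Ico 0 ρ)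
  psi_contDiffOn : ContDiffOn ℝ 1 Ψ (Ioo 0 ρ)
  deriv_pos : ∀ t ∈ Ioo 0 ρ, 0 < deriv Ψ t
  one_le_norm_grad : ∀ x : ↥Zᶜ, (x : M) ∈ U → f x ∈ Ioo 0 ρ →
    1 ≤ ‖grad (n := n) (fun y : ↥Zᶜ ↦ Ψ (f y)) x‖

/-- `f` is a Kurdyka–Łojasiewicz function: every `p ∈ ∂Z` is nondegenerate. -/
def IsKL (n : ℕ) (Z : Set M)
    [ChartedSpace (EuclideanSpace ℝ (Fin n)) ↥Zᶜ]
    [RiemannianBundle (fun x : ↥Zᶜ ↦ TangentSpace (𝓡 n) x)] (f : M → ℝ) : Prop :=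
  ∀ p ∈ frontier Z, ∃ (ρ : ℝ) (U : Set M) (Ψ : ℝ → ℝ),
    IsOpen U ∧ p ∈ U ∧ IsKLTriple n Z f ρ U Ψ

/-- `f` is a global Kurdyka–Łojasiewicz function with associated triple `(ρ, U, Ψ)`. -/
def IsGlobalKLWith (n : ℕ) (Z : Set M)
    [ChartedSpace (EuclideanSpace ℝ (Fin n)) ↥Zᶜ]
    [RiemannianBundle (fun x : ↥Zᶜ ↦ TangentSpace (𝓡 n) x)]
    (f : M → ℝ) (ρ : ℝ) (U : Set M) (Ψ : ℝ → ℝ) : Prop :=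
  U ∈ 𝓝ˢ (frontier Z) ∧ IsKLTriple n Z f ρ U Ψ

/-- The open neighbourhood `V` of `Z` has the three asserted properties. For an open interval `J`,
the limit along `atTop` of functions on `J` is the limit as `t` tends to the right end of `J`. -/
structure IsGoodNeighborhood (n : ℕ) (Z : Set M)
    [ChartedSpace (EuclideanSpace ℝ (Fin n)) ↥Zᶜ]
    [RiemannianBundle (fun x : ↥Zᶜ ↦ TangentSpace (𝓡 n) x)]
    (f : M → ℝ) (V : Set M) : Prop where
  isOpen : IsOpen V
  subset : Z ⊆ V
  /-- trajectories starting in `V ∖ Z` converge to points of `∂Z` -/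
  limit : ∀ x : ↥Zᶜ, (x : M) ∈ V → ∀ (α : ℝ → ↥Zᶜ) (J : Set ℝ),
    IsMaximalTrajectory (n := n) (fun y : ↥Zᶜ ↦ f y) x α J →
      ∃ p ∈ frontier Z, Tendsto (fun t : J ↦ (α t : M)) atTop (𝓝 p)
  /-- the forward-limit map, extended by the identity of `Z`, is a continuous retraction -/
  retraction : ∃ R : ↥V → ↥Z, Continuous R ∧
    (∀ x : ↥V, (x : M) ∈ Z → (R x : M) = x) ∧
    ∀ (x : ↥V) (hx : (x : M) ∈ Zᶜ) (α : ℝ → ↥Zᶜ) (J : Set ℝ),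
      IsMaximalTrajectory (n := n) (fun y : ↥Zᶜ ↦ f y) ⟨x, hx⟩ α J →
        Tendsto (fun t : J ↦ (α t : M)) atTop (𝓝 (R x : M))
  /-- the length of trajectories is a continuous function `V ∖ Z → (0, ∞)` -/
  length : ∃ L : ↥(V ∩ Zᶜ) → ℝ, Continuous L ∧
    ∀ x : ↥(V ∩ Zᶜ), 0 < L x ∧ ∀ (α : ℝ → ↥Zᶜ) (J : Set ℝ),
      IsMaximalTrajectory (n := n) (fun y : ↥Zᶜ ↦ f y) ⟨x, x.2.2⟩ α J →
        forwardLength (n := n) α J = ENNReal.ofReal (L x)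

end Relative

end KLFlow

end

/-! Since `|∇(Ψ ∘ f)| = Ψ'(f) |∇f| ≥ 1` near `∂Z`, a trajectory of `-∇f` satisfies `-(Ψ ∘ f)' =
Ψ'(f) |∇f|² ≥ |∇f|` there. Integrating, its length between two times is at most the drop of `Ψ ∘ f`
(`IsKLTriple.lintegral_slope_le`), and distances in `M` are bounded by lengths.

Fix `p ∈ ∂Z` and a compact ball of radius `2r` around it on which the inequality holds. A trajectory
starting within `r` of `p` at a point with `Ψ(f) < r` is too short to leave this ball
(`IsKLBall.dist_gradFlow_lt`). It is therefore Cauchy and converges inside the ball. A limit outside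
`Z` would be a critical point of `f` (`slope_eq_zero_of_tendsto`), which the inequality excludes; so
the limit lies in `Z`, and in `∂Z` because the trajectory avoids `Z`.

The part of the trajectory after time `t` has length at most `Ψ(f)` at time `t`. For fixed `t` this
is continuous in the starting point, so one `t` makes all nearby tails small
(`IsKLBall.exists_eventually_psi_lt`). Hence limit and length are locally uniform limits of
continuous functions of the starting point. At a point of `Z`, the retraction moves nearby points
`y` by at most `Ψ(f y)`, which tends to `0`. The required `V` is the union of the interior of `Z`
and these neighborhoods, cut down to `f < ρ` in the global case.

The argument rests on two general facts: the gradient of a `C²` function for a `C¹` metric is `C¹`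
(`contMDiff_grad`), and the maximal local flow of a `C¹` field is continuous on an open domain
(`continuousOn_flow`). -/

noncomputable section

namespace KLFlow

/-! ### Open intervals of the real line -/

section Interval

theorem exists_Ioo_subset {J : Set ℝ} (hJ : IsOpen J) (hJc : J.OrdConnected) {s t : ℝ}
    (hs : s ∈ J) (ht : t ∈ J) : ∃ a b, s ∈ Ioo a b ∧ t ∈ Ioo a b ∧ Ioo a b ⊆ J := by
  wlog hst : s ≤ t generalizing s t
  · obtain ⟨a, b, h₁, h₂, h₃⟩ := this ht hs (le_of_not_ge hst)
    exact ⟨a, b, h₂, h₁, h₃⟩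
  obtain ⟨ε, hε, hεs⟩ := Metric.isOpen_iff.1 hJ s hs
  obtain ⟨δ, hδ, hδt⟩ := Metric.isOpen_iff.1 hJ t ht
  refine ⟨s - ε, t + δ, ⟨by linarith, by linarith⟩, ⟨by linarith, by linarith⟩, fun u hu ↦ ?_⟩
  rcases lt_or_ge u s with h | h
  · apply hεs
    rw [Real.ball_eq_Ioo]
    exact ⟨hu.1, by linarith⟩
  rcases lt_or_ge t u with h' | h'
  · apply hδt
    rw [Real.ball_eq_Ioo]
    exact ⟨by linarith, hu.2⟩
  · exact hJc.out hs ht ⟨h, h'⟩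

theorem ordConnected_iUnion_of_mem {ι : Sort*} {J : ι → Set ℝ} {t₀ : ℝ}
    (hJ : ∀ i, (J i).OrdConnected) (h₀ : ∀ i, t₀ ∈ J i) : (⋃ i, J i).OrdConnected := by
  refine ⟨fun s hs t ht u hu ↦ ?_⟩
  obtain ⟨i, hi⟩ := mem_iUnion.1 hs
  obtain ⟨j, hj⟩ := mem_iUnion.1 ht
  rcases le_total u t₀ with h | h
  · exact mem_iUnion.2 ⟨i, (hJ i).out hi (h₀ i) ⟨hu.1, h⟩⟩
  · exact mem_iUnion.2 ⟨j, (hJ j).out (h₀ j) hj ⟨h, hu.2⟩⟩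

end Interval

/-! ### The maximal local flow of a `C¹` vector field -/

section Flow

variable {E : Type*} [NormedAddCommGroup E] [NormedSpace ℝ E]
  {H : Type*} [TopologicalSpace H] {I : ModelWithCorners ℝ E H}
  {N : Type*} [TopologicalSpace N] [ChartedSpace H N]
  {v : (x : N) → TangentSpace I x}

/-- `α` is an integral curve of `v` on the open interval `J ∋ 0` starting at `x`. -/
structure IsTrajectory (v : (x : N) → TangentSpace I x) (x : N) (α : ℝ → N) (J : Set ℝ) :
    Prop where
  isOpen : IsOpen J
  ordConnected : J.OrdConnected
  zero_mem : (0 : ℝ) ∈ J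
  initial : α 0 = x
  integralCurve : IsMIntegralCurveOn (I := I) α v J

/-- The domain of the maximal integral curve of `v` starting at `x`. -/
def maxInterval (v : (x : N) → TangentSpace I x) (x : N) : Set ℝ :=
  {t | ∃ α J, IsTrajectory v x α J ∧ t ∈ J}

open Classical in
/-- The maximal integral curve of `v` starting at `x`, with junk value `x` outside its domain. -/
def flow (v : (x : N) → TangentSpace I x) (x : N) (t : ℝ) : N :=
  if h : ∃ α J, IsTrajectory v x α J ∧ t ∈ J then h.choose t else x

theorem _root_.IsMIntegralCurveOn.congr_eqOn {α β : ℝ → N} {J : Set ℝ}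
    (hα : IsMIntegralCurveOn (I := I) α v J) (h : EqOn α β J) :
    IsMIntegralCurveOn (I := I) β v J := by
  intro t ht
  rw [← h ht]
  exact (hα t ht).congr_of_eventuallyEq
    (eventually_of_mem self_mem_nhdsWithin fun s hs ↦ (h hs).symm) (h ht).symm

theorem isMIntegralCurveOn_of_forall_eqOn {α : ℝ → N} {J : Set ℝ}
    (h : ∀ t ∈ J, ∃ β U, IsOpen U ∧ t ∈ U ∧ IsMIntegralCurveOn (I := I) β v U ∧ EqOn β α U) :
    IsMIntegralCurveOn (I := I) α v J := by
  apply IsMIntegralCurveAt.isMIntegralCurveOn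
  intro t ht
  obtain ⟨β, U, hU, htU, hβ, hβα⟩ := h t ht
  exact (hβ.congr_eqOn hβα).isMIntegralCurveAt (hU.mem_nhds htU)

theorem IsTrajectory.subset_maxInterval {x : N} {α : ℝ → N} {J : Set ℝ}
    (hα : IsTrajectory v x α J) : J ⊆ maxInterval v x :=
  fun _ ht ↦ ⟨α, J, hα, ht⟩

variable [IsManifold I 1 N]

/-- Carries a solution of the ODE in the fixed chart at `x₀` back to the manifold. The manifold
derivative is read in the chart at the current point, and the coordinate changes to `x₀` and back
cancel. -/
theorem hasMFDerivAt_extChartAt_symm_comp {x₀ : N} {c : ℝ → E} {t : ℝ}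
    (h : HasDerivAt c (tangentCoordChange I ((extChartAt I x₀).symm (c t)) x₀
      ((extChartAt I x₀).symm (c t)) (v ((extChartAt I x₀).symm (c t)))) t)
    (ht : c t ∈ interior (extChartAt I x₀).target) :
    HasMFDerivAt 𝓘(ℝ, ℝ) I ((extChartAt I x₀).symm ∘ c) t
      ((1 : ℝ →L[ℝ] ℝ).smulRight (v (((extChartAt I x₀).symm ∘ c) t))) := by
  let xₜ : N := (extChartAt I x₀).symm (c t)
  have hf3' := mem_of_mem_of_subset ht interior_subset
  have hft1 := mem_preimage.mp <|
    mem_of_mem_of_subset hf3' (extChartAt I x₀).target_subset_preimage_source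
  have hft2 := mem_extChartAt_source (I := I) xₜ
  let w : E := v xₜ
  have hw : tangentCoordChange I x₀ xₜ xₜ (tangentCoordChange I xₜ x₀ xₜ w) = w :=
    (tangentCoordChange_comp ⟨⟨hft2, hft1⟩, hft2⟩).trans (tangentCoordChange_self hft2)
  have hφ : HasFDerivAt (extChartAt I xₜ ∘ (extChartAt I x₀).symm)
      (tangentCoordChange I x₀ xₜ xₜ) (c t) := by
    apply HasFDerivWithinAt.hasFDerivAt (s := range I) _ <|
      mem_nhds_iff.mpr ⟨interior (extChartAt I x₀).target,
        subset_trans interior_subset (extChartAt_target_subset_range ..),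
        isOpen_interior, ht⟩
    rw [← (extChartAt I x₀).right_inv hf3']
    exact hasFDerivWithinAt_tangentCoordChange ⟨hft1, hft2⟩
  have hd : HasDerivAt ((extChartAt I xₜ ∘ (extChartAt I x₀).symm) ∘ c)
      (tangentCoordChange I x₀ xₜ xₜ (tangentCoordChange I xₜ x₀ xₜ w)) t :=
    hφ.comp_hasDerivAt _ h
  rw [hw] at hd
  have hd' : HasFDerivAt ((extChartAt I xₜ ∘ (extChartAt I x₀).symm) ∘ c)
      ((1 : ℝ →L[ℝ] ℝ).smulRight w) t := by
    refine hd.hasFDerivAt.congr_fderiv (ContinuousLinearMap.ext_ring ?_)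
    simp
  refine ⟨(continuousAt_extChartAt_symm'' hf3').comp h.continuousAt, ?_⟩
  simp only [writtenInExtChartAt, extChartAt_model_space_eq_id, PartialEquiv.refl_symm,
    PartialEquiv.refl_coe, Function.comp_id, id]
  exact hd'.hasFDerivWithinAt

variable [BoundarylessManifold I N]

theorem exists_isTrajectory
    [CompleteSpace E] (hv : ContMDiff I I.tangent 1 (fun x ↦ (⟨x, v x⟩ : TangentBundle I N))) (x : N) :
    ∃ α J, IsTrajectory v x α J := by
  obtain ⟨α, h₀, hα⟩ := exists_isMIntegralCurveAt_of_contMDiffAt_boundaryless 0 (hv x)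
  obtain ⟨ε, hε, hα⟩ := isMIntegralCurveAt_iff'.1 hα
  exact ⟨α, _, Metric.isOpen_ball, (convex_ball _ _).ordConnected, Metric.mem_ball_self hε, h₀, hα⟩

variable [T2Space N]

theorem _root_.IsMIntegralCurveOn.eqOn_inter
    (hv : ContMDiff I I.tangent 1 (fun x ↦ (⟨x, v x⟩ : TangentBundle I N)))
    {α β : ℝ → N} {J J' : Set ℝ} (hJ : IsOpen J) (hJc : J.OrdConnected) (hJ' : IsOpen J')
    (hJc' : J'.OrdConnected) (hα : IsMIntegralCurveOn (I := I) α v J)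
    (hβ : IsMIntegralCurveOn (I := I) β v J') {t₀ : ℝ} (ht₀ : t₀ ∈ J) (ht₀' : t₀ ∈ J')
    (h : α t₀ = β t₀) : EqOn α β (J ∩ J') := by
  intro t ht
  obtain ⟨a, b, h₁, h₂, h₃⟩ := exists_Ioo_subset (hJ.inter hJ') (hJc.inter hJc') ⟨ht₀, ht₀'⟩ ht
  exact isMIntegralCurveOn_Ioo_eqOn_of_contMDiff_boundaryless h₁ hv
    (hα.mono fun s hs ↦ (h₃ hs).1) (hβ.mono fun s hs ↦ (h₃ hs).2) h h₂

variable {x : N} {α β : ℝ → N} {J J' : Set ℝ}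

theorem IsTrajectory.eqOn
    (hv : ContMDiff I I.tangent 1 (fun x ↦ (⟨x, v x⟩ : TangentBundle I N)))
    (hα : IsTrajectory v x α J) (hβ : IsTrajectory v x β J') : EqOn α β (J ∩ J') :=
  hα.integralCurve.eqOn_inter hv hα.isOpen hα.ordConnected hβ.isOpen hβ.ordConnected
    hβ.integralCurve hα.zero_mem hβ.zero_mem (hα.initial.trans hβ.initial.symm)

theorem IsTrajectory.eqOn_flow
    (hv : ContMDiff I I.tangent 1 (fun x ↦ (⟨x, v x⟩ : TangentBundle I N)))
    (hα : IsTrajectory v x α J) : EqOn α (flow v x) J := by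
  intro t ht
  have h : ∃ α J, IsTrajectory v x α J ∧ t ∈ J := ⟨α, J, hα, ht⟩
  obtain ⟨J', hβ, ht'⟩ := h.choose_spec
  rw [flow, dif_pos h]
  exact hα.eqOn hv hβ ⟨ht, ht'⟩

variable [CompleteSpace E]

theorem isTrajectory_flow
    (hv : ContMDiff I I.tangent 1 (fun x ↦ (⟨x, v x⟩ : TangentBundle I N))) (x : N) :
    IsTrajectory v x (flow v x) (maxInterval v x) := by
  have hU : maxInterval v x = ⋃ p : {p : (ℝ → N) × Set ℝ // IsTrajectory v x p.1 p.2}, p.1.2 := by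
    ext t
    simp [maxInterval]
  obtain ⟨α, J, hα⟩ := exists_isTrajectory hv x
  refine ⟨?_, ?_, hα.subset_maxInterval hα.zero_mem, ?_, ?_⟩
  · rw [hU]
    exact isOpen_iUnion fun p ↦ p.2.isOpen
  · rw [hU]
    exact ordConnected_iUnion_of_mem (fun p ↦ p.2.ordConnected) fun p ↦ p.2.zero_mem
  · rw [← hα.eqOn_flow hv hα.zero_mem, hα.initial]
  · apply isMIntegralCurveOn_of_forall_eqOn
    rintro t ⟨β, J', hβ, ht⟩
    exact ⟨β, J', hβ.isOpen, ht, hβ.integralCurve, hβ.eqOn_flow hv⟩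

/-- The trajectory of `x` and the time-shifted trajectory of `flow v x t` agree on their overlap by
uniqueness. They glue to a trajectory of `x`, whose domain must lie in the maximal interval. -/
theorem flow_add
    (hv : ContMDiff I I.tangent 1 (fun x ↦ (⟨x, v x⟩ : TangentBundle I N))) {x : N} {s t : ℝ}
    (ht : t ∈ maxInterval v x) (hs : s ∈ maxInterval v (flow v x t)) :
    t + s ∈ maxInterval v x ∧ flow v x (t + s) = flow v (flow v x t) s := by
  classical
  have h₁ := isTrajectory_flow hv x
  have h₂ := isTrajectory_flow hv (flow v x t)
  set J₁ := maxInterval v x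
  set J₂ : Set ℝ := {u | u + -t ∈ maxInterval v (flow v x t)} with hJ₂
  set γ : ℝ → N := flow v (flow v x t) ∘ (· + -t) with hγ
  have hγc : IsMIntegralCurveOn (I := I) γ v J₂ := h₂.integralCurve.comp_add (-t)
  have hJ₂o : IsOpen J₂ := h₂.isOpen.preimage (by fun_prop)
  have hJ₂c : J₂.OrdConnected := h₂.ordConnected.preimage_mono (fun a b hab ↦ by simpa using hab)
  have htJ₂ : t ∈ J₂ := by simpa [hJ₂] using h₂.zero_mem
  have heq : EqOn (flow v x) γ (J₁ ∩ J₂) :=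
    h₁.integralCurve.eqOn_inter hv h₁.isOpen h₁.ordConnected hJ₂o hJ₂c hγc ht htJ₂
      (by simp [hγ, h₂.initial])
  set β : ℝ → N := J₁.piecewise (flow v x) γ
  have hβ₁ : EqOn (flow v x) β J₁ := (piecewise_eqOn _ _ _).symm
  have hβ₂ : EqOn γ β J₂ := by
    intro u hu
    by_cases hu₁ : u ∈ J₁
    · rw [← hβ₁ hu₁, heq ⟨hu₁, hu⟩]
    · exact (piecewise_eq_of_notMem _ _ _ hu₁).symm
  have hβ : IsTrajectory v x β (J₁ ∪ J₂) := by
    refine ⟨h₁.isOpen.union hJ₂o, ?_, .inl h₁.zero_mem, ?_, ?_⟩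
    · rw [union_eq_iUnion]
      refine ordConnected_iUnion_of_mem (t₀ := t) ?_ ?_
      · exact Bool.forall_bool.2 ⟨hJ₂c, h₁.ordConnected⟩
      · exact Bool.forall_bool.2 ⟨htJ₂, ht⟩
    · rw [← hβ₁ h₁.zero_mem, h₁.initial]
    · apply isMIntegralCurveOn_of_forall_eqOn
      rintro u (hu | hu)
      · exact ⟨_, J₁, h₁.isOpen, hu, h₁.integralCurve, hβ₁⟩
      · exact ⟨_, J₂, hJ₂o, hu, hγc, hβ₂⟩
  have hmem : t + s ∈ J₂ := by simpa [hJ₂] using hs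
  refine ⟨hβ.subset_maxInterval (.inr hmem), ?_⟩
  rw [← hβ.eqOn_flow hv (.inr hmem), ← hβ₂ hmem]
  simp [hγ]

/-- Picard–Lindelöf in a chart, with one existence time for all initial values in a ball and joint
continuity of the solution. -/
theorem exists_flow_box
    (hv : ContMDiff I I.tangent 1 (fun x ↦ (⟨x, v x⟩ : TangentBundle I N))) (p : N) :
    ∃ W : Set N, IsOpen W ∧ p ∈ W ∧ ∃ ε > 0,
      (∀ y ∈ W, Ioo (-ε) ε ⊆ maxInterval v y) ∧
      ContinuousOn (fun q : N × ℝ ↦ flow v q.1 q.2) (W ×ˢ Ioo (-ε) ε) := by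
  set φ := extChartAt I p with hφ
  set w : E → E := fun z ↦ tangentCoordChange I (φ.symm z) p (φ.symm z) (v (φ.symm z)) with hw
  have hwc : ContDiffAt ℝ 1 w (φ p) := by
    have := hv p
    rw [contMDiffAt_iff] at this
    exact (this.2.contDiffAt
      (range_mem_nhds_isInteriorPoint BoundarylessManifold.isInteriorPoint)).snd
  obtain ⟨ε₀, hε₀, a, r, L, K, hr, hpl⟩ := IsPicardLindelof.of_contDiffAt_one hwc
  obtain ⟨α, hα, hαc⟩ :=
    (hpl 0).exists_forall_mem_closedBall_eq_hasDerivWithinAt_continuousOn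
  simp only [zero_sub, zero_add] at hα hαc
  have hφp : φ p ∈ interior φ.target :=
    (I.isInteriorPoint_iff).mp BoundarylessManifold.isInteriorPoint
  have hr' : (0 : ℝ) < r := hr
  have hS : (Metric.closedBall (φ p) r) ×ˢ Icc (-ε₀) ε₀ ∈ 𝓝 (φ p, (0 : ℝ)) :=
    prod_mem_nhds (Metric.closedBall_mem_nhds _ hr') (Icc_mem_nhds (by linarith) hε₀)
  have h0 : α (φ p, 0) = φ p := (hα _ (Metric.mem_closedBall_self hr'.le)).1
  -- Solutions have to stay in the interior of the chart target to be carried back to `N`;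
  -- continuity at `(φ p, 0)` ensures this after shrinking.
  have hpre : α ⁻¹' interior φ.target ∈ 𝓝 (φ p, (0 : ℝ)) :=
    (hαc.continuousAt hS).preimage_mem_nhds (by rw [h0]; exact isOpen_interior.mem_nhds hφp)
  obtain ⟨u, hu, T, hT, huT⟩ := mem_nhds_prod_iff.1 (inter_mem hS hpre)
  obtain ⟨δ, hδ, hδu⟩ := Metric.mem_nhds_iff.1 hu
  obtain ⟨ε, hε, hεT⟩ := Metric.mem_nhds_iff.1 hT
  rw [Real.ball_eq_Ioo, zero_sub, zero_add] at hεT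
  have hsub : ∀ z ∈ Metric.ball (φ p) δ, ∀ t ∈ Ioo (-ε) ε,
      (z ∈ Metric.closedBall (φ p) r ∧ t ∈ Icc (-ε₀) ε₀) ∧ α (z, t) ∈ interior φ.target :=
    fun z hz t ht ↦ by
      have := huT (mk_mem_prod (hδu hz) (hεT ht))
      exact this
  set W : Set N := φ.source ∩ φ ⁻¹' Metric.ball (φ p) δ with hW
  have hWo : IsOpen W := (continuousOn_extChartAt p).isOpen_inter_preimage
    (isOpen_extChartAt_source p) Metric.isOpen_ball
  have htraj : ∀ y ∈ W, IsTrajectory v y (φ.symm ∘ fun t ↦ α (φ y, t)) (Ioo (-ε) ε) := by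
    intro y hy
    have hy0 := hsub _ hy.2 0 ⟨by linarith, hε⟩
    refine ⟨isOpen_Ioo, ordConnected_Ioo, ⟨by linarith, hε⟩, ?_, fun t ht ↦ ?_⟩
    · simp only [Function.comp_apply]
      rw [(hα _ hy0.1.1).1, φ.left_inv hy.1]
    · apply HasMFDerivAt.hasMFDerivWithinAt
      have hIoo : Ioo (-ε) ε ∈ 𝓝 t := isOpen_Ioo.mem_nhds ht
      refine hasMFDerivAt_extChartAt_symm_comp (v := v) ?_ (hsub _ hy.2 t ht).2
      exact ((hα _ hy0.1.1).2 t (hsub _ hy.2 t ht).1.2).hasDerivAt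
        (mem_of_superset hIoo fun s hs ↦ (hsub _ hy.2 s hs).1.2)
  refine ⟨W, hWo, ⟨mem_extChartAt_source p, Metric.mem_ball_self hδ⟩, ε, hε,
    fun y hy ↦ (htraj y hy).subset_maxInterval, ?_⟩
  have hcont : ContinuousOn (fun q : N × ℝ ↦ φ.symm (α (φ q.1, q.2))) (W ×ˢ Ioo (-ε) ε) := by
    refine (continuousOn_extChartAt_symm p).comp (hαc.comp ?_ ?_) ?_
    · exact ((continuousOn_extChartAt p).comp continuousOn_fst fun q hq ↦ hq.1.1).prodMk
        continuousOn_snd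
    · exact fun q hq ↦ (hsub _ hq.1.2 _ hq.2).1
    · exact fun q hq ↦ interior_subset (hsub _ hq.1.2 _ hq.2).2
  exact hcont.congr fun q hq ↦ ((htraj q.1 hq.1).eqOn_flow hv hq.2).symm

/-- A connectedness argument: the times with the asserted property contain `0`, form an open set,
and are relatively closed in the maximal interval. -/
theorem exists_continuousOn_flow
    (hv : ContMDiff I I.tangent 1 (fun x ↦ (⟨x, v x⟩ : TangentBundle I N))) {x : N} {t : ℝ}
    (ht : t ∈ maxInterval v x) :
    ∃ (W : Set N) (T : Set ℝ), IsOpen W ∧ x ∈ W ∧ IsOpen T ∧ t ∈ T ∧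
      (∀ y ∈ W, T ⊆ maxInterval v y) ∧
      ContinuousOn (fun q : N × ℝ ↦ flow v q.1 q.2) (W ×ˢ T) := by
  have hx := isTrajectory_flow hv x
  set S : Set ℝ := {t | ∃ (W : Set N) (T : Set ℝ), IsOpen W ∧ x ∈ W ∧ IsOpen T ∧ t ∈ T ∧
      (∀ y ∈ W, T ⊆ maxInterval v y) ∧
      ContinuousOn (fun q : N × ℝ ↦ flow v q.1 q.2) (W ×ˢ T)} with hS
  suffices h : maxInterval v x ⊆ S from h ht
  refine hx.ordConnected.isPreconnected.subset_of_closure_inter_subset ?_ ⟨0, hx.zero_mem, ?_⟩ ?_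
  · refine isOpen_iff_mem_nhds.2 ?_
    rintro t ⟨W, T, hW, hxW, hT, htT, h⟩
    exact mem_of_superset (hT.mem_nhds htT) fun s hs ↦ ⟨W, T, hW, hxW, hT, hs, h⟩
  · obtain ⟨W, hW, hxW, ε, hε, h⟩ := exists_flow_box hv x
    exact ⟨W, Ioo (-ε) ε, hW, hxW, isOpen_Ioo, ⟨by linarith, hε⟩, h⟩
  -- Closedness: take a good time `t₀` near `t` with `flow v x t₀` in a flow box around `flow v x
  -- t`, and flow for the remaining time `s - t₀` inside that box.
  · rintro t ⟨htS, ht⟩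
    obtain ⟨W, hW, hpW, ε, hε, hWJ, hWc⟩ := exists_flow_box hv (flow v x t)
    have hnhds : (flow v x ⁻¹' W) ∩ Ioo (t - ε) (t + ε) ∈ 𝓝 t :=
      inter_mem (((hx.integralCurve.continuousWithinAt ht).continuousAt
        (hx.isOpen.mem_nhds ht)).preimage_mem_nhds (hW.mem_nhds hpW))
        (Ioo_mem_nhds (by linarith) (by linarith))
    obtain ⟨t₀, ⟨ht₀W, ht₀⟩, W₀, T₀, hW₀, hxW₀, hT₀, ht₀T, hJ₀, hc₀⟩ :=
      mem_closure_iff_nhds.1 htS _ hnhds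
    have hc : ContinuousOn (fun y ↦ flow v y t₀) W₀ :=
      hc₀.comp (f := fun y ↦ (y, t₀)) (by fun_prop) fun y hy ↦ ⟨hy, ht₀T⟩
    have hflow : ∀ y ∈ W₀ ∩ (fun y ↦ flow v y t₀) ⁻¹' W, ∀ s ∈ Ioo (t₀ - ε) (t₀ + ε),
        s ∈ maxInterval v y ∧ flow v y s = flow v (flow v y t₀) (s - t₀) := by
      intro y hy s hs
      have := flow_add hv (hJ₀ y hy.1 ht₀T)
        (hWJ _ hy.2 (show s - t₀ ∈ Ioo (-ε) ε from ⟨by linarith [hs.1], by linarith [hs.2]⟩))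
      simpa using this
    refine ⟨W₀ ∩ (fun y ↦ flow v y t₀) ⁻¹' W, Ioo (t₀ - ε) (t₀ + ε),
      hc.isOpen_inter_preimage hW₀ hW, ⟨hxW₀, ht₀W⟩, isOpen_Ioo,
      ⟨by linarith [ht₀.2], by linarith [ht₀.1]⟩, fun y hy s hs ↦ (hflow y hy s hs).1, ?_⟩
    have hc' : ContinuousOn (fun q : N × ℝ ↦ flow v (flow v q.1 t₀) (q.2 - t₀))
        ((W₀ ∩ (fun y ↦ flow v y t₀) ⁻¹' W) ×ˢ Ioo (t₀ - ε) (t₀ + ε)) := by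
      refine hWc.comp (f := fun q : N × ℝ ↦ (flow v q.1 t₀, q.2 - t₀))
        ((hc.comp continuousOn_fst fun q hq ↦ hq.1.1).prodMk (by fun_prop)) ?_
      exact fun q hq ↦ ⟨hq.1.2, by linarith [hq.2.1], by linarith [hq.2.2]⟩
    exact hc'.congr fun q hq ↦ (hflow q.1 hq.1 q.2 hq.2).2

variable (v) in
/-- The domain of the maximal local flow of `v`. -/
def flowDomain : Set (N × ℝ) := {q | q.2 ∈ maxInterval v q.1}

theorem isOpen_flowDomain
    (hv : ContMDiff I I.tangent 1 (fun x ↦ (⟨x, v x⟩ : TangentBundle I N))) :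
    IsOpen (flowDomain v) := by
  refine isOpen_iff_mem_nhds.2 fun q hq ↦ ?_
  obtain ⟨W, T, hW, hxW, hT, htT, hJ, -⟩ := exists_continuousOn_flow hv hq
  exact mem_of_superset (prod_mem_nhds (hW.mem_nhds hxW) (hT.mem_nhds htT))
    fun q' hq' ↦ hJ _ hq'.1 hq'.2

theorem continuousOn_flow
    (hv : ContMDiff I I.tangent 1 (fun x ↦ (⟨x, v x⟩ : TangentBundle I N))) :
    ContinuousOn (fun q : N × ℝ ↦ flow v q.1 q.2) (flowDomain v) := by
  intro q hq
  obtain ⟨W, T, hW, hxW, hT, htT, -, hc⟩ := exists_continuousOn_flow hv hq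
  exact (hc.continuousAt (prod_mem_nhds (hW.mem_nhds hxW)
    (hT.mem_nhds htT))).continuousWithinAt

end Flow

/-! ### Regularity of the Riemannian gradient -/

section Gradient

variable {n : ℕ} {N : Type*} [TopologicalSpace N] [ChartedSpace (EuclideanSpace ℝ (Fin n)) N]
  [IsManifold (𝓡 n) 2 N]

theorem eq_zero_of_trivializationAt_symm_eq_zero {x₀ x : N}
    (hx : x ∈ (trivializationAt (EuclideanSpace ℝ (Fin n)) (TangentSpace (𝓡 n)) x₀).baseSet)
    {v : EuclideanSpace ℝ (Fin n)}
    (hv : (trivializationAt (EuclideanSpace ℝ (Fin n)) (TangentSpace (𝓡 n)) x₀).symm x v = 0) :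
    v = 0 := by
  set e := trivializationAt (EuclideanSpace ℝ (Fin n)) (TangentSpace (𝓡 n)) x₀
  have := congrArg Prod.snd (e.apply_mk_symm hx v)
  rw [hv] at this
  exact this.symm.trans (e.linear ℝ hx).map_zero

variable [RiemannianBundle (fun x : N ↦ TangentSpace (𝓡 n) x)]
  [IsContMDiffRiemannianBundle (𝓡 n) 1 (EuclideanSpace ℝ (Fin n))
      (fun x : N ↦ TangentSpace (𝓡 n) x)]

theorem isInvertible_of_injective {F : Type*} [NormedAddCommGroup F] [NormedSpace ℝ F]
    [FiniteDimensional ℝ F] (A : F →L[ℝ] F →L[ℝ] ℝ) (hA : Function.Injective A) :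
    A.IsInvertible := by
  have hd : Module.finrank ℝ F = Module.finrank ℝ (F →L[ℝ] ℝ) := by
    rw [← LinearEquiv.finrank_eq (LinearMap.toContinuousLinearMap (𝕜 := ℝ) (E := F) (F' := ℝ))]
    exact Subspace.dual_finrank_eq.symm
  refine ⟨(LinearEquiv.ofInjectiveOfFinrankEq (A : F →ₗ[ℝ] F →L[ℝ] ℝ) hA hd).toContinuousLinearEquiv,
    ?_⟩
  ext; rfl

/-- In a trivialization the metric becomes a `C¹` family `A` of invertible operators and the
differential a `C¹` covector `D`. The gradient is `A⁻¹ D`, and operator inversion is smooth. -/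
theorem contMDiff_grad {g : N → ℝ} (hg : ContMDiff (𝓡 n) 𝓘(ℝ, ℝ) 2 g) :
    ContMDiff (𝓡 n) (𝓡 n).tangent 1 (fun x ↦ (⟨x, grad g x⟩ : TangentBundle (𝓡 n) N)) := by
  set F := EuclideanSpace ℝ (Fin n)
  obtain ⟨G, hG, hGi⟩ := IsContMDiffRiemannianBundle.exists_contMDiff (IB := 𝓡 n) (n := 1)
    (F := F) (E := fun x : N ↦ TangentSpace (𝓡 n) x)
  intro x₀
  rw [contMDiffAt_section]
  have hA := hG x₀
  rw [contMDiffAt_section] at hA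
  simp only [hom_trivializationAt_apply] at hA
  have hD := (hg x₀).mfderiv_const (m := 1) (by rw [one_add_one_eq_two])
  set e := trivializationAt F (TangentSpace (𝓡 n)) x₀ with he
  set A : N → F →L[ℝ] F →L[ℝ] ℝ := fun x ↦ ContinuousLinearMap.inCoordinates F
    (TangentSpace (𝓡 n)) (F →L[ℝ] ℝ) (fun x : N ↦ TangentSpace (𝓡 n) x →L[ℝ] ℝ) x₀ x x₀ x (G x)
  set D : N → F →L[ℝ] ℝ := inTangentCoordinates (𝓡 n) 𝓘(ℝ, ℝ) id g (mfderiv (𝓡 n) 𝓘(ℝ, ℝ) g) x₀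
  have hAapp : ∀ x ∈ e.baseSet, ∀ v w : F, A x v w = inner ℝ (e.symm x v) (e.symm x w) := by
    intro x hx v w
    rw [hGi]
    simp only [A]
    rw [inCoordinates_apply_eq₂ hx hx (mem_univ _)]
    simp
    rfl
  have hDapp : ∀ x ∈ e.baseSet, ∀ w : F, D x w = mfderiv (𝓡 n) 𝓘(ℝ, ℝ) g x (e.symm x w) := by
    intro x hx w
    simp only [D, inTangentCoordinates, ContinuousLinearMap.inCoordinates]
    rw [TangentBundle.continuousLinearMapAt_model_space]
    change mfderiv (𝓡 n) 𝓘(ℝ, ℝ) g x (e.symmL ℝ x w) = _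
    rw [Trivialization.symmL_apply (R := ℝ) (e := e) (hb := hx) (y := w)]
  have hx₀ : x₀ ∈ e.baseSet := FiberBundle.mem_baseSet_trivializationAt' x₀
  -- Positive definiteness of the metric gives injectivity, which suffices in finite dimension.
  have hinv : (A x₀).IsInvertible := by
    refine isInvertible_of_injective _ ((injective_iff_map_eq_zero _).2 fun v hv ↦ ?_)
    have h0 := hAapp x₀ hx₀ v v
    rw [hv] at h0
    exact eq_zero_of_trivializationAt_symm_eq_zero hx₀ (inner_self_eq_zero.1 h0.symm)
  have hAc : ContinuousAt A x₀ := hA.continuousAt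
  have hev : ∀ᶠ x in 𝓝 x₀, (A x).IsInvertible := by
    obtain ⟨M, hM⟩ := hinv
    have := hAc.preimage_mem_nhds (hM ▸ ContinuousLinearEquiv.nhds M)
    exact this
  have hcomp : ContMDiffAt (𝓡 n) 𝓘(ℝ, F) 1 (fun x ↦ (A x).inverse (D x)) x₀ := by
    have h1 : ContMDiffAt (𝓡 n) 𝓘(ℝ, (F →L[ℝ] ℝ) →L[ℝ] F) 1 (fun x ↦ (A x).inverse) x₀ :=
      ContDiffAt.comp_contMDiffAt (f := A) (g := ContinuousLinearMap.inverse)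
        hinv.contDiffAt_map_inverse hA
    exact h1.clm_apply hD
  refine hcomp.congr_of_eventuallyEq ?_
  filter_upwards [hev, e.open_baseSet.mem_nhds hx₀] with x hx hxe
  have hu : A x (e ⟨x, grad g x⟩).2 = D x := by
    ext w
    rw [hAapp x hxe, hDapp x hxe, ← inner_grad]
    congr 1
    exact e.symm_apply_apply_mk hxe _
  rw [← hu, hx.inverse_apply_self]

end Gradient

/-! ### Integral curves are `C¹` -/

section IntegralCurve

variable {E : Type*} [NormedAddCommGroup E] [NormedSpace ℝ E]
  {H : Type*} [TopologicalSpace H] {I : ModelWithCorners ℝ E H}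
  {N : Type*} [TopologicalSpace N] [ChartedSpace H N] [IsManifold I 1 N]
  {v : (x : N) → TangentSpace I x}

/-- In a chart the derivative is the vector field along the curve, hence continuous. The comparison
of lengths in `IsRelativeManifold` is available for `C¹` curves only. -/
theorem _root_.IsMIntegralCurveAt.contMDiffAt
    (hv : ContMDiff I I.tangent 1 (fun x ↦ (⟨x, v x⟩ : TangentBundle I N))) {γ : ℝ → N} {t₀ : ℝ}
    (hγ : IsMIntegralCurveAt (I := I) γ v t₀) : ContMDiffAt 𝓘(ℝ, ℝ) I 1 γ t₀ := by
  rw [contMDiffAt_iff_target]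
  refine ⟨hγ.continuousAt, ContDiffAt.contMDiffAt ?_⟩
  have hs : ContMDiffAt I 𝓘(ℝ, E) 1
      (fun x ↦ (trivializationAt E (TangentSpace I) (γ t₀) ⟨x, v x⟩).2) (γ t₀) :=
    (contMDiffAt_section _).1 (hv _)
  obtain ⟨u, hu, hsu⟩ := (contMDiffAt_iff_contMDiffOn_nhds (by simp)).1 hs
  obtain ⟨u', hu'u, hu'o, hmem⟩ := mem_nhds_iff.1 hu
  obtain ⟨T, hT, hγT⟩ := isMIntegralCurveAt_iff.1 hγ
  have hder := hγ.eventually_hasDerivAt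
  obtain ⟨S, hS, hSo, htS⟩ := eventually_nhds_iff.1 (hder.and (eventually_mem_nhds_iff.2
    (inter_mem hT (hγ.continuousAt.preimage_mem_nhds (hu'o.mem_nhds hmem)))))
  refine contDiffAt_one_iff.2 ⟨fun t ↦ (1 : ℝ →L[ℝ] ℝ).smulRight
    (tangentCoordChange I (γ t) (γ t₀) (γ t) (v (γ t))), S, hSo.mem_nhds htS, ?_,
    fun t ht ↦ (hS t ht).1.hasFDerivAt⟩
  have hc : ContinuousOn (fun t ↦ tangentCoordChange I (γ t) (γ t₀) (γ t) (v (γ t))) S := by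
    have : ContinuousOn γ S := fun t ht ↦
      ((hγT.isMIntegralCurveAt (mem_of_superset (hS t ht).2
        inter_subset_left)).continuousAt).continuousWithinAt
    exact hsu.continuousOn.comp this fun t ht ↦ hu'u (mem_of_mem_nhds (hS t ht).2).2
  exact ((ContinuousLinearMap.smulRightL ℝ ℝ E (1 : ℝ →L[ℝ] ℝ)).continuous).comp_continuousOn hc

end IntegralCurve

/-! ### The negative gradient flow -/

section GradientFlow

variable {n : ℕ} {N : Type*} [TopologicalSpace N] [ChartedSpace (EuclideanSpace ℝ (Fin n)) N]
  [RiemannianBundle (fun x : N ↦ TangentSpace (𝓡 n) x)]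

/-- The vector field `-∇ g`. -/
def negGrad (g : N → ℝ) (x : N) : TangentSpace (𝓡 n) x := -grad g x

variable {g : N → ℝ} {x : N} {α : ℝ → N} {J : Set ℝ}

theorem mfderiv_of_isMIntegralCurveOn (hJ : IsOpen J)
    (hα : IsMIntegralCurveOn (I := 𝓡 n) α (negGrad g) J) {t : ℝ} (ht : t ∈ J) :
    HasMFDerivAt 𝓘(ℝ, ℝ) (𝓡 n) α t ((1 : ℝ →L[ℝ] ℝ).smulRight (negGrad (n := n) g (α t))) :=
  (hα t ht).hasMFDerivAt (hJ.mem_nhds ht)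

theorem enorm_mfderiv_of_isMIntegralCurveOn (hJ : IsOpen J)
    (hα : IsMIntegralCurveOn (I := 𝓡 n) α (negGrad g) J) {t : ℝ} (ht : t ∈ J) :
    ‖mfderiv 𝓘(ℝ, ℝ) (𝓡 n) α t 1‖ₑ = ‖grad (n := n) g (α t)‖ₑ := by
  rw [(mfderiv_of_isMIntegralCurveOn hJ hα ht).mfderiv]
  have : ((1 : ℝ →L[ℝ] ℝ).smulRight (negGrad (n := n) g (α t))) (1 : ℝ) = -grad g (α t) := by
    simp [negGrad]
  erw [this]
  exact enorm_neg _

theorem mfderiv_negGrad (g : N → ℝ) (x : N) :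
    @Eq ℝ (-‖grad (n := n) g x‖ ^ 2) (mfderiv (𝓡 n) 𝓘(ℝ, ℝ) g x (negGrad g x)) := by
  rw [negGrad, ← inner_grad, inner_neg_right, real_inner_self_eq_norm_sq]

theorem hasDerivAt_comp_of_isMIntegralCurveOn (hg : MDifferentiable (𝓡 n) 𝓘(ℝ, ℝ) g)
    (hJ : IsOpen J)
    (hα : IsMIntegralCurveOn (I := 𝓡 n) α (negGrad g) J) {t : ℝ} (ht : t ∈ J) :
    HasDerivAt (fun t ↦ g (α t)) (-‖grad (n := n) g (α t)‖ ^ 2) t := by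
  have := (hg (α t)).hasMFDerivAt.comp t (mfderiv_of_isMIntegralCurveOn hJ hα ht)
  rw [hasMFDerivAt_iff_hasFDerivAt] at this
  rw [hasDerivAt_iff_hasFDerivAt, mfderiv_negGrad]
  refine this.congr_fderiv ?_
  apply ContinuousLinearMap.ext_ring
  change mfderiv (𝓡 n) 𝓘(ℝ, ℝ) g (α t) ((1 : ℝ) • negGrad g (α t)) =
    (1 : ℝ) • (mfderiv (𝓡 n) 𝓘(ℝ, ℝ) g (α t) (negGrad g (α t)))
  rw [one_smul, one_smul]

theorem IsMaximalTrajectory.isTrajectory (h : IsMaximalTrajectory (n := n) g x α J) :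
    IsTrajectory (I := 𝓡 n) (negGrad g) x α J :=
  ⟨h.isOpen, h.ordConnected, h.zero_mem, h.initial, h.integralCurve⟩

variable [IsManifold (𝓡 n) 2 N]
  [IsContMDiffRiemannianBundle (𝓡 n) 1 (EuclideanSpace ℝ (Fin n))
      (fun x : N ↦ TangentSpace (𝓡 n) x)]

theorem continuous_norm_grad (hg : ContMDiff (𝓡 n) 𝓘(ℝ, ℝ) 2 g) :
    Continuous fun x ↦ ‖grad (n := n) g x‖ := by
  have h := contMDiff_grad hg
  have h2 := (ContMDiff.inner_bundle (n := 1) (IB := 𝓡 n) (F := EuclideanSpace ℝ (Fin n))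
    (E := fun x : N ↦ TangentSpace (𝓡 n) x) (b := fun x ↦ x) h h).continuous
  simp only [real_inner_self_eq_norm_sq] at h2
  simpa [Real.sqrt_sq] using h2.sqrt

theorem contMDiff_negGrad (hg : ContMDiff (𝓡 n) 𝓘(ℝ, ℝ) 2 g) :
    ContMDiff (𝓡 n) (𝓡 n).tangent 1 (fun x ↦ (⟨x, negGrad g x⟩ : TangentBundle (𝓡 n) N)) :=
  (contMDiff_grad hg).neg_section

variable [T2Space N]

theorem isMaximalTrajectory_flow (hg : ContMDiff (𝓡 n) 𝓘(ℝ, ℝ) 2 g) (x : N) :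
    IsMaximalTrajectory (n := n) g x (flow (negGrad (n := n) g) x)
      (maxInterval (negGrad (n := n) g) x) := by
  have h := isTrajectory_flow (contMDiff_negGrad hg) x
  refine ⟨h.isOpen, h.ordConnected, h.zero_mem, h.initial, h.integralCurve, ?_⟩
  intro β J' hJ' hJc' hsub hβ heq
  refine Subset.antisymm ?_ hsub
  have hβ' : IsTrajectory (I := 𝓡 n) (negGrad g) x β J' :=
    ⟨hJ', hJc', hsub h.zero_mem, (heq h.zero_mem).symm.trans h.initial, hβ⟩
  exact hβ'.subset_maxInterval

/-- By uniqueness the flow extends `α`, so maximality leaves no room. This reduces claims about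
arbitrary maximal trajectories to the flow. -/
theorem IsMaximalTrajectory.eq_maxInterval (hg : ContMDiff (𝓡 n) 𝓘(ℝ, ℝ) 2 g)
    (h : IsMaximalTrajectory (n := n) g x α J) : J = maxInterval (negGrad (n := n) g) x := by
  have h' := isTrajectory_flow (contMDiff_negGrad hg) x
  exact (h.maximal _ _ h'.isOpen h'.ordConnected h.isTrajectory.subset_maxInterval
    h'.integralCurve (h.isTrajectory.eqOn_flow (contMDiff_negGrad hg))).symm

theorem IsMaximalTrajectory.eqOn_flow (hg : ContMDiff (𝓡 n) 𝓘(ℝ, ℝ) 2 g)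
    (h : IsMaximalTrajectory (n := n) g x α J) : EqOn α (flow (negGrad (n := n) g) x) J :=
  h.isTrajectory.eqOn_flow (contMDiff_negGrad hg)

theorem IsMaximalTrajectory.forwardLength_eq (hg : ContMDiff (𝓡 n) 𝓘(ℝ, ℝ) 2 g)
    (h : IsMaximalTrajectory (n := n) g x α J) :
    forwardLength (n := n) α J = ∫⁻ t in maxInterval (negGrad (n := n) g) x ∩ Ici 0,
      ‖grad (n := n) g (flow (negGrad (n := n) g) x t)‖ₑ := by
  rw [forwardLength, ← h.eq_maxInterval hg]
  refine setLIntegral_congr_fun (h.isOpen.measurableSet.inter measurableSet_Ici) fun t ht ↦ ?_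
  rw [enorm_mfderiv_of_isMIntegralCurveOn h.isOpen h.integralCurve ht.1]
  rw [h.eqOn_flow hg ht.1]

theorem hasDerivAt_comp_flow (hg : ContMDiff (𝓡 n) 𝓘(ℝ, ℝ) 2 g) {x : N} {t : ℝ}
    (ht : t ∈ maxInterval (negGrad (n := n) g) x) :
    HasDerivAt (fun t ↦ g (flow (negGrad (n := n) g) x t))
      (-‖grad (n := n) g (flow (negGrad (n := n) g) x t)‖ ^ 2) t :=
  have h := isTrajectory_flow (contMDiff_negGrad hg) x
  hasDerivAt_comp_of_isMIntegralCurveOn (hg.mdifferentiable two_ne_zero) h.isOpen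
    h.integralCurve ht

theorem antitoneOn_comp_flow (hg : ContMDiff (𝓡 n) 𝓘(ℝ, ℝ) 2 g) (x : N) :
    AntitoneOn (fun t ↦ g (flow (negGrad (n := n) g) x t))
      (maxInterval (negGrad (n := n) g) x) := by
  have h := isTrajectory_flow (contMDiff_negGrad hg) x
  refine antitoneOn_of_deriv_nonpos h.ordConnected.convex
    (fun t ht ↦ (hasDerivAt_comp_flow hg ht).continuousAt.continuousWithinAt)
    (fun t ht ↦ (hasDerivAt_comp_flow hg
      (interior_subset ht)).differentiableAt.differentiableWithinAt) fun t ht ↦ ?_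
  rw [(hasDerivAt_comp_flow hg (interior_subset ht)).deriv]
  nlinarith [sq_nonneg ‖grad (n := n) g (flow (negGrad (n := n) g) x t)‖]

theorem continuousAt_integral_norm_grad_flow (hg : ContMDiff (𝓡 n) 𝓘(ℝ, ℝ) 2 g) {x : N} {t : ℝ}
    (ht : t ∈ maxInterval (negGrad (n := n) g) x) (ht0 : 0 ≤ t) [FirstCountableTopology N] :
    ContinuousAt (fun y ↦ ∫ s in (0 : ℝ)..t,
      ‖grad (n := n) g (flow (negGrad (n := n) g) y s)‖) x := by
  set v := negGrad (n := n) g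
  have hv := contMDiff_negGrad hg
  have h := isTrajectory_flow hv x
  set F : N × ℝ → ℝ := fun q ↦ ‖grad (n := n) g (flow v q.1 q.2)‖
  have hF : ContinuousOn F (flowDomain v) :=
    (continuous_norm_grad hg).comp_continuousOn (continuousOn_flow hv)
  have hsub : ({x} : Set N) ×ˢ Icc 0 t ⊆ flowDomain v := by
    rintro ⟨y, s⟩ ⟨rfl, hs⟩
    exact h.ordConnected.out h.zero_mem ht hs
  obtain ⟨C, hC⟩ := (isCompact_singleton.prod isCompact_Icc).bddAbove_image (hF.mono hsub)
  have hO : IsOpen (flowDomain v ∩ F ⁻¹' Iio (C + 1)) :=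
    hF.isOpen_inter_preimage (isOpen_flowDomain hv) isOpen_Iio
  -- The tube lemma extends the bound on the compact set `{x} × [0, t]` to `C + 1` for all nearby
  -- starting points, which is the domination needed below.
  obtain ⟨W, T, hW, hT, hxW, hT', hWT⟩ := generalized_tube_lemma (isCompact_singleton (x := x))
    (isCompact_Icc (a := (0 : ℝ)) (b := t)) hO fun q hq ↦
      ⟨hsub hq, (hC (mem_image_of_mem F hq)).trans_lt (lt_add_one C)⟩
  have hWx : W ∈ 𝓝 x := hW.mem_nhds (hxW rfl)
  refine intervalIntegral.continuousAt_of_dominated_interval (bound := fun _ ↦ C + 1) ?_ ?_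
    intervalIntegrable_const ?_
  · filter_upwards [hWx] with y hy
    refine (ContinuousOn.mono (s := Icc 0 t) ?_ ?_).aestronglyMeasurable measurableSet_uIoc
    · exact hF.comp (f := fun s ↦ (y, s)) (by fun_prop) fun s hs ↦ (hWT ⟨hy, hT' hs⟩).1
    · rw [uIoc_of_le ht0]
      exact Ioc_subset_Icc_self
  · filter_upwards [hWx] with y hy
    refine .of_forall fun s hs ↦ ?_
    rw [uIoc_of_le ht0] at hs
    rw [norm_norm]
    exact (hWT (mk_mem_prod hy (hT' (Ioc_subset_Icc_self hs)))).2.le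
  · refine .of_forall fun s hs ↦ ?_
    rw [uIoc_of_le ht0] at hs
    have hm := hsub (mk_mem_prod (mem_singleton x) (Ioc_subset_Icc_self hs))
    exact (hF.continuousAt ((isOpen_flowDomain hv).mem_nhds hm)).comp
      (f := fun y ↦ (y, s)) (by fun_prop)

end GradientFlow

theorem IsRelativeFunction.pos {n : ℕ} {M : Type*} [MetricSpace M] {Z : Set M}
    [ChartedSpace (EuclideanSpace ℝ (Fin n)) ↥Zᶜ] {f : M → ℝ} {l : ℕ∞ω}
    (hf : IsRelativeFunction n l Z f) (x : ↥Zᶜ) : 0 < f x :=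
  (hf.nonneg x).lt_of_ne fun h ↦ x.2 ((hf.eq_zero_iff x).1 h.symm)

/-! ### Length estimates from the Kurdyka–Łojasiewicz inequality -/

section KLEstimates

variable {n : ℕ} {M : Type*} [MetricSpace M] {Z : Set M}
  [ChartedSpace (EuclideanSpace ℝ (Fin n)) ↥Zᶜ]
  [RiemannianBundle (fun x : ↥Zᶜ ↦ TangentSpace (𝓡 n) x)]

variable (n Z) in
/-- The domain of the maximal trajectory of `-∇ f` starting at `x`. -/
abbrev flowInterval (f : M → ℝ) (x : ↥Zᶜ) : Set ℝ :=
  maxInterval (negGrad (n := n) fun y : ↥Zᶜ ↦ f y) x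

variable (n Z) in
/-- The maximal trajectory of `-∇ f` starting at `x`. -/
abbrev gradFlow (f : M → ℝ) (x : ↥Zᶜ) (t : ℝ) : ↥Zᶜ :=
  flow (negGrad (n := n) fun y : ↥Zᶜ ↦ f y) x t

variable (n Z) in
/-- The length of the gradient of `f` on `M ∖ Z`. -/
abbrev slope (f : M → ℝ) (x : ↥Zᶜ) : ℝ := ‖grad (n := n) (fun y : ↥Zᶜ ↦ f y) x‖

variable {f : M → ℝ} {ρ : ℝ} {U : Set M} {Ψ : ℝ → ℝ}

theorem IsKLTriple.mono {U' : Set M} (h : IsKLTriple n Z f ρ U Ψ) (hU : U' ⊆ U) :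
    IsKLTriple n Z f ρ U' Ψ :=
  { h with one_le_norm_grad := fun x hx ↦ h.one_le_norm_grad x (hU hx) }

theorem IsKLTriple.hasDerivAt (h : IsKLTriple n Z f ρ U Ψ) {t : ℝ} (ht : t ∈ Ioo 0 ρ) :
    HasDerivAt Ψ (deriv Ψ t) t :=
  ((h.psi_contDiffOn.differentiableOn one_ne_zero).differentiableAt
    (isOpen_Ioo.mem_nhds ht)).hasDerivAt

theorem IsKLTriple.psi_nonneg (h : IsKLTriple n Z f ρ U Ψ) {t : ℝ} (ht : t ∈ Ico 0 ρ) :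
    0 ≤ Ψ t := by
  rcases ht.1.eq_or_lt with h0 | h0
  · rw [← h0, h.psi_zero]
  · exact (h.psi_pos t ⟨h0, ht.2⟩).le

theorem IsKLTriple.continuousAt_psi (h : IsKLTriple n Z f ρ U Ψ)
    (hf : IsRelativeFunction n 2 Z f) {x : M} (hx : f x < ρ) :
    ContinuousAt (fun y ↦ Ψ (f y)) x := by
  have h1 : IsOpen {x | f x < ρ} := isOpen_lt hf.continuous continuous_const
  have h2 : ContinuousOn (fun x ↦ Ψ (f x)) {x | f x < ρ} :=
    h.psi_continuousOn.comp hf.continuous.continuousOn fun x hx ↦ ⟨hf.nonneg x, hx⟩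
  exact h2.continuousAt (h1.mem_nhds hx)

theorem norm_grad_comp {φ : ℝ → ℝ} {N : Type*} [TopologicalSpace N]
    [ChartedSpace (EuclideanSpace ℝ (Fin n)) N]
    [RiemannianBundle (fun x : N ↦ TangentSpace (𝓡 n) x)] {g : N → ℝ} {x : N} {φ' : ℝ}
    (hφ : HasDerivAt φ φ' (g x)) (hg : MDifferentiableAt (𝓡 n) 𝓘(ℝ, ℝ) g x) :
    ‖grad (n := n) (fun y ↦ φ (g y)) x‖ = |φ'| * ‖grad (n := n) g x‖ := by
  suffices h : grad (n := n) (fun y ↦ φ (g y)) x = φ' • grad (n := n) g x by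
    rw [h, norm_smul, Real.norm_eq_abs]
  refine ext_inner_right ℝ fun v ↦ ?_
  rw [inner_smul_left, inner_grad, inner_grad]
  have h := (hφ.hasFDerivAt.hasMFDerivAt.comp x hg.hasMFDerivAt).mfderiv
  have h' : mfderiv (𝓡 n) 𝓘(ℝ, ℝ) (fun y ↦ φ (g y)) x v =
    (ContinuousLinearMap.toSpanSingleton ℝ φ') (mfderiv (𝓡 n) 𝓘(ℝ, ℝ) g x v : ℝ) := by
    exact congrArg (fun L ↦ L v) h
  refine h'.trans ?_
  exact @mul_comm ℝ _ _ φ'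

theorem IsKLTriple.one_le_deriv_mul_slope (h : IsKLTriple n Z f ρ U Ψ)
    (hf : IsRelativeFunction n 2 Z f) {x : ↥Zᶜ} (hx : (x : M) ∈ U) (hfx : f x < ρ) :
    1 ≤ deriv Ψ (f x) * slope n Z f x := by
  have hx' : f x ∈ Ioo 0 ρ := ⟨hf.pos x, hfx⟩
  have := h.one_le_norm_grad x hx hx'
  rwa [norm_grad_comp (n := n) (g := fun y : ↥Zᶜ ↦ f y) (h.hasDerivAt hx') (hf.contMDiff.mdifferentiable two_ne_zero x),
    abs_of_pos (h.deriv_pos _ hx')] at this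

variable (n Z) in
/-- A Kurdyka–Łojasiewicz triple on a compact ball of radius `2 * r`. -/
structure IsKLBall (f : M → ℝ) (p : M) (r ρ : ℝ) (Ψ : ℝ → ℝ) : Prop where
  triple : IsKLTriple n Z f ρ (Metric.closedBall p (2 * r)) Ψ
  isCompact : IsCompact (Metric.closedBall p (2 * r))
  pos : 0 < r

/-- The points near `p` whose forward trajectories are too short to leave the ball of radius
`2 * r`. -/
def klNhd (f : M → ℝ) (p : M) (r ρ : ℝ) (Ψ : ℝ → ℝ) : Set M :=
  {x | dist x p < r ∧ f x < ρ ∧ Ψ (f x) < r}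

variable {p : M} {r : ℝ}

theorem IsKLBall.isOpen_klNhd (h : IsKLBall n Z f p r ρ Ψ) (hf : IsRelativeFunction n 2 Z f) :
    IsOpen (klNhd f p r ρ Ψ) := by
  have h1 : IsOpen {x | f x < ρ} := isOpen_lt hf.continuous continuous_const
  have h2 : ContinuousOn (fun x ↦ Ψ (f x)) {x | f x < ρ} := fun x hx ↦
    (h.triple.continuousAt_psi hf hx).continuousWithinAt
  exact Metric.isOpen_ball.inter (h2.isOpen_inter_preimage h1 isOpen_Iio)

variable [IsManifold (𝓡 n) 2 ↥Zᶜ]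

variable [IsContMDiffRiemannianBundle (𝓡 n) 1 (EuclideanSpace ℝ (Fin n))
      (fun x : ↥Zᶜ ↦ TangentSpace (𝓡 n) x)]

theorem IsRelativeFunction.isTrajectory (hf : IsRelativeFunction n 2 Z f) (x : ↥Zᶜ) :
    IsTrajectory (I := 𝓡 n) (negGrad fun y : ↥Zᶜ ↦ f y) x (gradFlow n Z f x)
      (flowInterval n Z f x) :=
  isTrajectory_flow (contMDiff_negGrad hf.contMDiff) x

theorem continuousOn_slope_gradFlow (hf : IsRelativeFunction n 2 Z f) (x : ↥Zᶜ) :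
    ContinuousOn (fun t ↦ slope n Z f (gradFlow n Z f x t)) (flowInterval n Z f x) :=
  (continuous_norm_grad hf.contMDiff).comp_continuousOn
    (hf.isTrajectory x).integralCurve.continuousOn

theorem lintegral_slope_Icc (hf : IsRelativeFunction n 2 Z f) {x : ↥Zᶜ} {a b : ℝ}
    (ha : a ∈ flowInterval n Z f x) (hb : b ∈ flowInterval n Z f x) (hab : a ≤ b) :
    ∫⁻ t in Icc a b, ‖grad (n := n) (fun y : ↥Zᶜ ↦ f y) (gradFlow n Z f x t)‖ₑ =
      ENNReal.ofReal (∫ t in a..b, slope n Z f (gradFlow n Z f x t)) := by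
  have hsub : Icc a b ⊆ flowInterval n Z f x := (hf.isTrajectory x).ordConnected.out ha hb
  rw [intervalIntegral.integral_of_le hab, ← integral_Icc_eq_integral_Ioc,
    ofReal_integral_eq_lintegral_ofReal]
  · simp only [ofReal_norm]
  · exact ((continuousOn_slope_gradFlow hf x).mono hsub).integrableOn_Icc
  · exact .of_forall fun t ↦ norm_nonneg _

/-- The distance of the endpoints is at most the variation of the curve, which is its Riemannian
length by `length_eq`. -/
theorem edist_gradFlow_le (hZ : IsRelativeManifold n Z) (hf : IsRelativeFunction n 2 Z f)
    {x : ↥Zᶜ} {a b : ℝ} (ha : a ∈ flowInterval n Z f x) (hb : b ∈ flowInterval n Z f x)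
    (hab : a ≤ b) : edist (gradFlow n Z f x a : M) (gradFlow n Z f x b) ≤
      ∫⁻ t in Icc a b, ‖grad (n := n) (fun y : ↥Zᶜ ↦ f y) (gradFlow n Z f x t)‖ₑ := by
  have h := hf.isTrajectory x
  have hsub : Icc a b ⊆ flowInterval n Z f x := h.ordConnected.out ha hb
  have hc : ContMDiffOn 𝓘(ℝ, ℝ) (𝓡 n) 1 (gradFlow n Z f x) (Icc a b) := fun t ht ↦
    ((h.integralCurve.isMIntegralCurveAt (h.isOpen.mem_nhds (hsub ht))).contMDiffAt
      (contMDiff_negGrad hf.contMDiff)).contMDiffWithinAt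
  have hvar := eVariationOn.edist_le (fun t ↦ (gradFlow n Z f x t : M))
    (left_mem_Icc.2 hab) (right_mem_Icc.2 hab)
  rw [hZ.length_eq _ a b hab hc, Manifold.pathELength_eq_lintegral_mfderiv_Icc] at hvar
  refine hvar.trans_eq (setLIntegral_congr_fun measurableSet_Icc fun t ht ↦ ?_)
  exact enorm_mfderiv_of_isMIntegralCurveOn h.isOpen h.integralCurve (hsub ht)

theorem antitoneOn_gradFlow (hf : IsRelativeFunction n 2 Z f) (x : ↥Zᶜ) :
    AntitoneOn (fun t ↦ f (gradFlow n Z f x t)) (flowInterval n Z f x) :=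
  antitoneOn_comp_flow hf.contMDiff x

/-- The derivative of `-Ψ ∘ f` along the flow is `Ψ'(f) |∇f|² ≥ |∇f|`. Membership in `U` is needed
only at interior times, which suits a first exit time. -/
theorem IsKLTriple.lintegral_slope_le (h : IsKLTriple n Z f ρ U Ψ)
    (hf : IsRelativeFunction n 2 Z f) {x : ↥Zᶜ} {a b : ℝ}
    (ha : a ∈ flowInterval n Z f x) (hb : b ∈ flowInterval n Z f x) (hab : a ≤ b)
    (hU : ∀ t ∈ Ioo a b, (gradFlow n Z f x t : M) ∈ U) (hρ : f (gradFlow n Z f x a) < ρ) :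
    ∫⁻ t in Icc a b, ‖grad (n := n) (fun y : ↥Zᶜ ↦ f y) (gradFlow n Z f x t)‖ₑ ≤
      ENNReal.ofReal (Ψ (f (gradFlow n Z f x a)) - Ψ (f (gradFlow n Z f x b))) := by
  have hsub : Icc a b ⊆ flowInterval n Z f x := (hf.isTrajectory x).ordConnected.out ha hb
  have hmem : ∀ t ∈ Icc a b, f (gradFlow n Z f x t) ∈ Ioo 0 ρ := fun t ht ↦
    ⟨hf.pos _, (antitoneOn_gradFlow hf x ha (hsub ht) ht.1).trans_lt hρ⟩
  have hder : ∀ t ∈ Icc a b, HasDerivAt (fun t ↦ -Ψ (f (gradFlow n Z f x t)))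
      (deriv Ψ (f (gradFlow n Z f x t)) * slope n Z f (gradFlow n Z f x t) ^ 2) t := by
    intro t ht
    have := ((h.hasDerivAt (hmem t ht)).comp t (hasDerivAt_comp_flow hf.contMDiff (hsub ht))).neg
    exact this.congr_deriv (by ring)
  rw [lintegral_slope_Icc hf ha hb hab]
  refine ENNReal.ofReal_le_ofReal ?_
  have := intervalIntegral.integral_le_sub_of_hasDeriv_right_of_le hab
    (fun t ht ↦ (hder t ht).continuousAt.continuousWithinAt)
    (fun t ht ↦ (hder t (Ioo_subset_Icc_self ht)).hasDerivWithinAt)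
    (((continuousOn_slope_gradFlow hf x).mono hsub).integrableOn_Icc)
    (fun t ht ↦ ?_)
  · linarith
  · have h1 := h.one_le_deriv_mul_slope hf (hU t ht) (hmem t (Ioo_subset_Icc_self ht)).2
    nlinarith [norm_nonneg (grad (n := n) (fun y : ↥Zᶜ ↦ f y) (gradFlow n Z f x t))]

theorem IsKLBall.dist_gradFlow_lt (h : IsKLBall n Z f p r ρ Ψ) (hZ : IsRelativeManifold n Z)
    (hf : IsRelativeFunction n 2 Z f) {x : ↥Zᶜ} (hx : (x : M) ∈ klNhd f p r ρ Ψ) {t : ℝ}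
    (ht : t ∈ flowInterval n Z f x) (ht0 : 0 ≤ t) : dist (gradFlow n Z f x t : M) p < 2 * r := by
  by_contra! hcon
  have htr := hf.isTrajectory x
  have h0 : gradFlow n Z f x 0 = x := htr.initial
  have hsub : Icc 0 t ⊆ flowInterval n Z f x := htr.ordConnected.out htr.zero_mem ht
  have hc : ContinuousOn (fun s ↦ dist (gradFlow n Z f x s : M) p) (Icc 0 t) :=
    (continuous_subtype_val.dist continuous_const).comp_continuousOn
      (htr.integralCurve.continuousOn.mono hsub)
  have hcl : IsClosed (Icc 0 t ∩ (fun s ↦ dist (gradFlow n Z f x s : M) p) ⁻¹' Ici (2 * r)) :=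
    hc.preimage_isClosed_of_isClosed isClosed_Icc isClosed_Ici
  -- At the first time `s` at distance at least `2 * r` from `p`, the point would be more than `r`
  -- away from `x`, although the length up to `s` is at most `Ψ (f x) < r`.
  obtain ⟨s, ⟨hs, hs2⟩, hmin⟩ := (isCompact_Icc.of_isClosed_subset hcl
    inter_subset_left).exists_isLeast ⟨t, ⟨ht0, le_rfl⟩, hcon⟩
  have hin : ∀ u ∈ Ioo 0 s, (gradFlow n Z f x u : M) ∈ Metric.closedBall p (2 * r) := by
    intro u hu
    by_contra hu'
    exact hu.2.not_ge (hmin ⟨⟨hu.1.le, hu.2.le.trans hs.2⟩,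
      (not_le.1 (fun h ↦ hu' (Metric.mem_closedBall.2 h))).le⟩)
  have hle := (edist_gradFlow_le hZ hf htr.zero_mem (hsub hs) hs.1).trans
    (h.triple.lintegral_slope_le hf htr.zero_mem (hsub hs) hs.1 hin (by rw [h0]; exact hx.2.1))
  have hfs : f (gradFlow n Z f x s) ∈ Ico 0 ρ := ⟨hf.nonneg _, lt_of_le_of_lt
    (antitoneOn_gradFlow hf x htr.zero_mem (hsub hs) hs.1) (by simpa only [h0] using hx.2.1)⟩
  rw [h0, edist_dist, ENNReal.ofReal_le_ofReal_iff'] at hle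
  have hnn := h.triple.psi_nonneg hfs
  have htri := dist_triangle_left (gradFlow n Z f x s : M) p x
  have hx1 := hx.1
  have hx2 := hx.2.2
  have hs3 : 2 * r ≤ dist (gradFlow n Z f x s : M) p := hs2
  have hr := h.pos
  rcases hle with hle | hle
  · linarith
  · linarith

theorem f_gradFlow_mem (hf : IsRelativeFunction n 2 Z f) {x : ↥Zᶜ}
    (hx : (x : M) ∈ klNhd f p r ρ Ψ) {t : ℝ} (ht : t ∈ flowInterval n Z f x) (ht0 : 0 ≤ t) :
    f (gradFlow n Z f x t) ∈ Ioo 0 ρ := by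
  have htr := hf.isTrajectory x
  have h0 : gradFlow n Z f x 0 = x := htr.initial
  refine ⟨hf.pos _, lt_of_le_of_lt (antitoneOn_gradFlow hf x htr.zero_mem ht ht0) ?_⟩
  simpa only [h0] using hx.2.1

theorem IsKLBall.lintegral_slope_le (h : IsKLBall n Z f p r ρ Ψ) (hZ : IsRelativeManifold n Z)
    (hf : IsRelativeFunction n 2 Z f) {x : ↥Zᶜ} (hx : (x : M) ∈ klNhd f p r ρ Ψ) {a b : ℝ}
    (ha : a ∈ flowInterval n Z f x) (ha0 : 0 ≤ a) (hb : b ∈ flowInterval n Z f x) (hab : a ≤ b) :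
    ∫⁻ t in Icc a b, ‖grad (n := n) (fun y : ↥Zᶜ ↦ f y) (gradFlow n Z f x t)‖ₑ ≤
      ENNReal.ofReal (Ψ (f (gradFlow n Z f x a)) - Ψ (f (gradFlow n Z f x b))) :=
  h.triple.lintegral_slope_le hf ha hb hab (fun _ ht ↦ (h.dist_gradFlow_lt hZ hf hx
    ((hf.isTrajectory x).ordConnected.out ha hb (Ioo_subset_Icc_self ht))
      (ha0.trans ht.1.le)).le) (f_gradFlow_mem hf hx ha ha0).2

theorem IsKLBall.psi_nonneg (h : IsKLBall n Z f p r ρ Ψ)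
    (hf : IsRelativeFunction n 2 Z f) {x : ↥Zᶜ} (hx : (x : M) ∈ klNhd f p r ρ Ψ) {t : ℝ}
    (ht : t ∈ flowInterval n Z f x) (ht0 : 0 ≤ t) : 0 ≤ Ψ (f (gradFlow n Z f x t)) :=
  h.triple.psi_nonneg (Ioo_subset_Ico_self (f_gradFlow_mem hf hx ht ht0))

theorem IsKLBall.dist_gradFlow_le (h : IsKLBall n Z f p r ρ Ψ) (hZ : IsRelativeManifold n Z)
    (hf : IsRelativeFunction n 2 Z f) {x : ↥Zᶜ} (hx : (x : M) ∈ klNhd f p r ρ Ψ) {a b : ℝ}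
    (ha : a ∈ flowInterval n Z f x) (ha0 : 0 ≤ a) (hb : b ∈ flowInterval n Z f x) (hab : a ≤ b) :
    dist (gradFlow n Z f x a : M) (gradFlow n Z f x b) ≤
      Ψ (f (gradFlow n Z f x a)) - Ψ (f (gradFlow n Z f x b)) := by
  have hle := (edist_gradFlow_le hZ hf ha hb hab).trans (h.lintegral_slope_le hZ hf hx ha ha0 hb hab)
  have hmem := fun {t} ht ht0 ↦ f_gradFlow_mem (t := t) hf hx ht ht0
  -- Monotonicity of `Ψ` makes the drop nonnegative, so that `ENNReal.ofReal` truncates nothing.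
  have hmono : StrictMonoOn Ψ (Ioo 0 ρ) := strictMonoOn_of_deriv_pos (convex_Ioo 0 ρ)
    h.triple.psi_contDiffOn.continuousOn fun t ht ↦ h.triple.deriv_pos t (interior_subset ht)
  have hab' : Ψ (f (gradFlow n Z f x b)) ≤ Ψ (f (gradFlow n Z f x a)) :=
    hmono.monotoneOn (hmem hb (ha0.trans hab)) (hmem ha ha0) (antitoneOn_gradFlow hf x ha hb hab)
  rw [edist_dist] at hle
  exact (ENNReal.ofReal_le_ofReal_iff (sub_nonneg.2 hab')).1 hle

/-- Exhaust the tail by compact intervals; on each the drop of `Ψ ∘ f` is at most its initial value,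
as `Ψ ≥ 0`. -/
theorem IsKLBall.lintegral_slope_tail_le (h : IsKLBall n Z f p r ρ Ψ)
    (hZ : IsRelativeManifold n Z) (hf : IsRelativeFunction n 2 Z f) {x : ↥Zᶜ}
    (hx : (x : M) ∈ klNhd f p r ρ Ψ) {a : ℝ} (ha : a ∈ flowInterval n Z f x) (ha0 : 0 ≤ a) :
    ∫⁻ t in flowInterval n Z f x ∩ Ici a,
        ‖grad (n := n) (fun y : ↥Zᶜ ↦ f y) (gradFlow n Z f x t)‖ₑ ≤
      ENNReal.ofReal (Ψ (f (gradFlow n Z f x a))) := by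
  have htr := hf.isTrajectory x
  have : Nonempty (flowInterval n Z f x) := ⟨0, htr.zero_mem⟩
  have := htr.ordConnected
  obtain ⟨b, hbm, hb⟩ := exists_seq_monotone_tendsto_atTop_atTop (flowInterval n Z f x)
  have hsub : flowInterval n Z f x ∩ Ici a ⊆ ⋃ k, Icc a (b k : ℝ) := by
    rintro t ⟨ht, hat⟩
    obtain ⟨k, hk⟩ := (hb.eventually_ge_atTop ⟨t, ht⟩).exists
    exact mem_iUnion.2 ⟨k, hat, hk⟩
  refine (lintegral_mono_set hsub).trans ?_
  rw [setLIntegral_iUnion_of_directed _ (s := fun k ↦ Icc a (b k : ℝ))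
    (Monotone.directed_le fun i j hij ↦ Icc_subset_Icc_right (hbm hij))]
  refine iSup_le fun k ↦ ?_
  rcases le_or_gt a (b k) with hk | hk
  · refine (h.lintegral_slope_le hZ hf hx ha ha0 (b k).2 hk).trans (ENNReal.ofReal_le_ofReal ?_)
    linarith [h.psi_nonneg hf hx (b k).2 (ha0.trans hk)]
  · simp [Icc_eq_empty_of_lt hk]

theorem IsKLBall.exists_tendsto (h : IsKLBall n Z f p r ρ Ψ)
    (hZ : IsRelativeManifold n Z) (hf : IsRelativeFunction n 2 Z f) {x : ↥Zᶜ}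
    (hx : (x : M) ∈ klNhd f p r ρ Ψ) :
    ∃ q ∈ Metric.closedBall p (2 * r),
      Tendsto (fun t : flowInterval n Z f x ↦ (gradFlow n Z f x t : M)) atTop (𝓝 q) := by
  have htr := hf.isTrajectory x
  let t₀ : flowInterval n Z f x := ⟨0, htr.zero_mem⟩
  have : Nonempty (flowInterval n Z f x) := ⟨t₀⟩
  set s : flowInterval n Z f x → ℝ := fun t ↦ Ψ (f (gradFlow n Z f x t))
  have hbdd : BddBelow (s '' Ici t₀) := by
    refine ⟨0, ?_⟩
    rintro _ ⟨t, ht, rfl⟩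
    exact h.psi_nonneg hf hx t.2 ht
  have hcauchy : CauchySeq fun t : flowInterval n Z f x ↦ (gradFlow n Z f x t : M) := by
    refine Metric.cauchySeq_iff'.2 fun ε hε ↦ ?_
    -- From a time at which `Ψ ∘ f` is within `ε` of its infimum on, it drops by less than `ε`, so
    -- the trajectory moves by less than `ε`.
    obtain ⟨_, ⟨N, hN, rfl⟩, hlt⟩ := exists_lt_of_csInf_lt (Nonempty.image s ⟨t₀, self_mem_Ici⟩)
      (lt_add_of_pos_right (sInf (s '' Ici t₀)) hε)
    refine ⟨N, fun t ht ↦ ?_⟩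
    have h1 := csInf_le hbdd (mem_image_of_mem s (show t ∈ Ici t₀ from le_trans hN ht))
    have h2 := h.dist_gradFlow_le hZ hf hx N.2 hN t.2 ht
    rw [dist_comm]
    simp only [s] at h1 hlt
    linarith
  have hmem : ∀ᶠ t : flowInterval n Z f x in atTop,
      (gradFlow n Z f x t : M) ∈ Metric.closedBall p (2 * r) := by
    filter_upwards [eventually_ge_atTop t₀] with t ht
    exact (h.dist_gradFlow_lt hZ hf hx t.2 ht).le
  exact h.isCompact.isComplete _ hcauchy (le_principal_iff.2 hmem)

/-- Since `f` decreases to `f q` along the trajectory of `x`, it is constant for a short time along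
that of `q`. Its derivative there, minus the squared slope, vanishes at time `0`. -/
theorem slope_eq_zero_of_tendsto (hf : IsRelativeFunction n 2 Z f) {x q : ↥Zᶜ}
    (hq : Tendsto (fun t : flowInterval n Z f x ↦ gradFlow n Z f x t) atTop (𝓝 q)) :
    slope n Z f q = 0 := by
  have hv := contMDiff_negGrad hf.contMDiff
  have htr := hf.isTrajectory x
  have htq := hf.isTrajectory q
  have : Nonempty (flowInterval n Z f x) := ⟨0, htr.zero_mem⟩
  have hfq : Tendsto (fun t : flowInterval n Z f x ↦ f (gradFlow n Z f x t)) atTop (𝓝 (f q)) :=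
    ((hf.continuous.comp continuous_subtype_val).tendsto q).comp hq
  have hge : ∀ t ∈ flowInterval n Z f x, f q ≤ f (gradFlow n Z f x t) := by
    intro t ht
    refine le_of_tendsto hfq ?_
    filter_upwards [eventually_ge_atTop ⟨t, ht⟩] with t' ht'
    exact antitoneOn_gradFlow hf x ht t'.2 ht'
  obtain ⟨W, hW, hqW, ε, hε, hWJ, hWc⟩ := exists_flow_box hv q
  have hconst : ∀ s ∈ Ico 0 ε, f (gradFlow n Z f q s) = f q := by
    intro s hs
    have hs' : s ∈ Ioo (-ε) ε := ⟨by linarith [hs.1], hs.2⟩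
    -- Late points lie in the flow box of `q`, so the trajectory can be continued by time `s`. The
    -- values of `f` there are squeezed between `f q` and those at time `t`.
    have hadd : ∀ᶠ t : flowInterval n Z f x in atTop, (t + s : ℝ) ∈ flowInterval n Z f x ∧
        gradFlow n Z f x (t + s) = gradFlow n Z f (gradFlow n Z f x t) s := by
      filter_upwards [hq (hW.mem_nhds hqW)] with t ht
      exact flow_add hv t.2 (hWJ _ ht hs')
    have hcs : ContinuousAt (fun y ↦ gradFlow n Z f y s) q :=
      (hWc.continuousAt (prod_mem_nhds (hW.mem_nhds hqW) (Ioo_mem_nhds hs'.1 hs'.2))).comp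
        (f := fun y ↦ (y, s)) (by fun_prop)
    have h1 : Tendsto (fun t : flowInterval n Z f x ↦
        f (gradFlow n Z f (gradFlow n Z f x t) s)) atTop (𝓝 (f (gradFlow n Z f q s))) :=
      ((hf.continuous.comp continuous_subtype_val).tendsto _).comp (hcs.tendsto.comp hq)
    refine tendsto_nhds_unique h1 (tendsto_of_tendsto_of_tendsto_of_le_of_le'
      tendsto_const_nhds hfq ?_ ?_)
    · filter_upwards [hadd] with t ht
      rw [← ht.2]
      exact hge _ ht.1
    · filter_upwards [hadd] with t ht
      rw [← ht.2]
      exact antitoneOn_gradFlow hf x t.2 ht.1 (by linarith [hs.1])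
  have hd := (hasDerivAt_comp_flow hf.contMDiff htq.zero_mem).hasDerivWithinAt (s := Ici 0)
  have h0 : gradFlow n Z f q 0 = q := htq.initial
  have hd' : HasDerivWithinAt (fun t ↦ f (gradFlow n Z f q t)) 0 (Ici 0) 0 := by
    refine (hasDerivWithinAt_const (0 : ℝ) (Ici 0) (f q)).congr_of_eventuallyEq ?_ (by rw [h0])
    filter_upwards [Ico_mem_nhdsGE hε] with s hs
    exact hconst s hs
  have := (uniqueDiffWithinAt_Ici (0 : ℝ)).eq_deriv _ hd hd'
  change -slope n Z f (gradFlow n Z f q 0) ^ 2 = 0 at this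
  rw [h0] at this
  simpa using this

theorem IsKLBall.mem_frontier_of_tendsto (h : IsKLBall n Z f p r ρ Ψ)
    (hf : IsRelativeFunction n 2 Z f) {x : ↥Zᶜ}
    (hx : (x : M) ∈ klNhd f p r ρ Ψ) {q : M} (hqp : q ∈ Metric.closedBall p (2 * r))
    (hq : Tendsto (fun t : flowInterval n Z f x ↦ (gradFlow n Z f x t : M)) atTop (𝓝 q)) :
    q ∈ frontier Z := by
  have htr := hf.isTrajectory x
  have h0 : gradFlow n Z f x 0 = x := htr.initial
  have : Nonempty (flowInterval n Z f x) := ⟨0, htr.zero_mem⟩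
  have hqZ : q ∈ Z := by
    by_contra hcon
    have hs := slope_eq_zero_of_tendsto hf (q := ⟨q, hcon⟩) (tendsto_subtype_rng.2 hq)
    have hfq : f q ≤ f x := by
      refine le_of_tendsto ((hf.continuous.tendsto q).comp hq) ?_
      filter_upwards [eventually_ge_atTop ⟨0, htr.zero_mem⟩] with t ht
      have := antitoneOn_gradFlow hf x htr.zero_mem t.2 ht
      simpa only [h0, Function.comp_apply] using this
    -- A critical point outside `Z`, in the ball and with `f q < ρ`, would violate the inequality.
    have := h.triple.one_le_deriv_mul_slope hf (x := ⟨q, hcon⟩) hqp (hfq.trans_lt hx.2.1)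
    rw [hs, mul_zero] at this
    linarith
  refine ⟨subset_closure hqZ, fun hint ↦ ?_⟩
  obtain ⟨t, ht⟩ := (hq.eventually (isOpen_interior.mem_nhds hint)).exists
  exact (gradFlow n Z f x t).2 (interior_subset ht)

theorem IsKLBall.dist_limit_le (h : IsKLBall n Z f p r ρ Ψ)
    (hZ : IsRelativeManifold n Z) (hf : IsRelativeFunction n 2 Z f) {x : ↥Zᶜ}
    (hx : (x : M) ∈ klNhd f p r ρ Ψ) {q : M}
    (hq : Tendsto (fun t : flowInterval n Z f x ↦ (gradFlow n Z f x t : M)) atTop (𝓝 q))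
    {a : ℝ} (ha : a ∈ flowInterval n Z f x) (ha0 : 0 ≤ a) :
    dist (gradFlow n Z f x a : M) q ≤ Ψ (f (gradFlow n Z f x a)) := by
  have : Nonempty (flowInterval n Z f x) := ⟨a, ha⟩
  refine le_of_tendsto (tendsto_const_nhds.dist hq) ?_
  filter_upwards [eventually_ge_atTop ⟨a, ha⟩] with t ht
  have hat : a ≤ t := ht
  linarith [h.dist_gradFlow_le hZ hf hx ha ha0 t.2 ht, h.psi_nonneg hf hx t.2 (ha0.trans hat)]

theorem edist_limit_le (hZ : IsRelativeManifold n Z) (hf : IsRelativeFunction n 2 Z f) {x : ↥Zᶜ}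
    {q : M} (hq : Tendsto (fun t : flowInterval n Z f x ↦ (gradFlow n Z f x t : M)) atTop (𝓝 q)) :
    edist (x : M) q ≤ ∫⁻ t in flowInterval n Z f x ∩ Ici 0,
        ‖grad (n := n) (fun y : ↥Zᶜ ↦ f y) (gradFlow n Z f x t)‖ₑ := by
  have htr := hf.isTrajectory x
  have h0 : gradFlow n Z f x 0 = x := htr.initial
  have : Nonempty (flowInterval n Z f x) := ⟨0, htr.zero_mem⟩
  refine le_of_tendsto (tendsto_const_nhds.edist hq) ?_
  filter_upwards [eventually_ge_atTop ⟨0, htr.zero_mem⟩] with t ht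
  have := edist_gradFlow_le hZ hf htr.zero_mem t.2 ht
  rw [h0] at this
  exact this.trans (lintegral_mono_set fun s hs ↦
    ⟨htr.ordConnected.out htr.zero_mem t.2 hs, hs.1⟩)

theorem IsKLBall.tendsto_psi (h : IsKLBall n Z f p r ρ Ψ)
    (hf : IsRelativeFunction n 2 Z f) {x : ↥Zᶜ} (hx : (x : M) ∈ klNhd f p r ρ Ψ) {q : M}
    (hqZ : q ∈ Z)
    (hq : Tendsto (fun t : flowInterval n Z f x ↦ (gradFlow n Z f x t : M)) atTop (𝓝 q)) :
    Tendsto (fun t : flowInterval n Z f x ↦ Ψ (f (gradFlow n Z f x t))) atTop (𝓝 0) := by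
  have htr := hf.isTrajectory x
  have : Nonempty (flowInterval n Z f x) := ⟨0, htr.zero_mem⟩
  have hfq : Tendsto (fun t : flowInterval n Z f x ↦ f (gradFlow n Z f x t)) atTop (𝓝 0) := by
    rw [← (hf.eq_zero_iff q).2 hqZ]
    exact (hf.continuous.tendsto q).comp hq
  have hΨ := h.triple.psi_continuousOn 0 ⟨le_rfl, h.triple.rho_pos⟩
  rw [ContinuousWithinAt, h.triple.psi_zero] at hΨ
  refine hΨ.comp (tendsto_nhdsWithin_iff.2 ⟨hfq, ?_⟩)
  filter_upwards [eventually_ge_atTop ⟨0, htr.zero_mem⟩] with t ht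
  exact Ioo_subset_Ico_self (f_gradFlow_mem hf hx t.2 ht)

end KLEstimates

/-! ### Continuity of the limit and of the length, and the neighborhood `V` -/

section Retraction

variable {n : ℕ} {M : Type*} [MetricSpace M] {Z : Set M}
  [ChartedSpace (EuclideanSpace ℝ (Fin n)) ↥Zᶜ]
  [RiemannianBundle (fun x : ↥Zᶜ ↦ TangentSpace (𝓡 n) x)]

theorem IsKL.exists_isKLBall [LocallyCompactSpace M] {f : M → ℝ} (hf : IsKL n Z f) {p : M}
    (hp : p ∈ frontier Z) : ∃ r ρ Ψ, IsKLBall n Z f p r ρ Ψ := by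
  obtain ⟨ρ, U, Ψ, hU, hpU, h⟩ := hf p hp
  obtain ⟨r, hr, hcomp⟩ := Metric.exists_isCompact_closedBall p
  obtain ⟨ε, hε, hball⟩ := Metric.nhds_basis_closedBall.mem_iff.1 (hU.mem_nhds hpU)
  refine ⟨min r ε / 2, ρ, Ψ, ⟨h.mono ?_, ?_, by positivity⟩⟩
  · refine (Metric.closedBall_subset_closedBall ?_).trans hball
    linarith [min_le_right r ε]
  · refine hcomp.of_isClosed_subset Metric.isClosed_closedBall
      (Metric.closedBall_subset_closedBall ?_)
    linarith [min_le_left r ε]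

theorem IsGlobalKLWith.isKL {f : M → ℝ} {ρ : ℝ} {U : Set M} {Ψ : ℝ → ℝ}
    (h : IsGlobalKLWith n Z f ρ U Ψ) : IsKL n Z f := fun _ hp ↦
  ⟨ρ, interior U, Ψ, isOpen_interior, subset_interior_iff_mem_nhdsSet.2 h.1 hp,
    h.2.mono interior_subset⟩

variable {f : M → ℝ} {ρ : ℝ} {Ψ : ℝ → ℝ} {p : M} {r : ℝ}

theorem IsKLBall.self_mem_klNhd (h : IsKLBall n Z f p r ρ Ψ)
    (hf : IsRelativeFunction n 2 Z f) (hp : p ∈ Z) : p ∈ klNhd f p r ρ Ψ := by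
  have h0 := (hf.eq_zero_iff p).2 hp
  refine ⟨by simpa using h.pos, ?_, ?_⟩
  · rw [h0]
    exact h.triple.rho_pos
  · rw [h0, h.triple.psi_zero]
    exact h.pos

variable [IsManifold (𝓡 n) 2 ↥Zᶜ]
  [IsContMDiffRiemannianBundle (𝓡 n) 1 (EuclideanSpace ℝ (Fin n))
      (fun x : ↥Zᶜ ↦ TangentSpace (𝓡 n) x)]

theorem continuousAt_gradFlow (hf : IsRelativeFunction n 2 Z f) {x : ↥Zᶜ} {t : ℝ}
    (ht : t ∈ flowInterval n Z f x) : ContinuousAt (fun y ↦ gradFlow n Z f y t) x :=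
  have hv := contMDiff_negGrad hf.contMDiff
  ((continuousOn_flow hv).continuousAt ((isOpen_flowDomain hv).mem_nhds
    (show (x, t) ∈ flowDomain _ from ht))).comp (f := fun y ↦ (y, t)) (by fun_prop)

theorem eventually_mem_flowInterval (hf : IsRelativeFunction n 2 Z f) {x : ↥Zᶜ} {t : ℝ}
    (ht : t ∈ flowInterval n Z f x) : ∀ᶠ y in 𝓝 x, t ∈ flowInterval n Z f y :=
  have hc : ContinuousAt (fun y : ↥Zᶜ ↦ (y, t)) x := by fun_prop
  hc.eventually ((isOpen_flowDomain (contMDiff_negGrad hf.contMDiff)).mem_nhds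
    (show (x, t) ∈ flowDomain _ from ht))

/-- Choose `t` for `x` alone, using that `Ψ ∘ f` tends to `0` along its trajectory. Continuity of
the time-`t` map then gives the bound for all nearby `y`, uniformly controlling their tails. -/
theorem IsKLBall.exists_eventually_psi_lt (h : IsKLBall n Z f p r ρ Ψ)
    (hZ : IsRelativeManifold n Z) (hf : IsRelativeFunction n 2 Z f) {x : ↥Zᶜ}
    (hx : (x : M) ∈ klNhd f p r ρ Ψ) {ε : ℝ} (hε : 0 < ε) :
    ∃ t ∈ flowInterval n Z f x, 0 ≤ t ∧ ∀ᶠ y : ↥Zᶜ in 𝓝 x, (y : M) ∈ klNhd f p r ρ Ψ ∧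
      t ∈ flowInterval n Z f y ∧ Ψ (f (gradFlow n Z f y t)) < ε := by
  have htr := hf.isTrajectory x
  have : Nonempty (flowInterval n Z f x) := ⟨0, htr.zero_mem⟩
  obtain ⟨q, hqp, hq⟩ := h.exists_tendsto hZ hf hx
  have hqZ := hZ.isClosed.frontier_subset (h.mem_frontier_of_tendsto hf hx hqp hq)
  obtain ⟨⟨t, ht⟩, hlt, ht0⟩ := (((h.tendsto_psi hf hx hqZ hq).eventually (gt_mem_nhds hε)).and
    (eventually_ge_atTop ⟨0, htr.zero_mem⟩)).exists
  refine ⟨t, ht, ht0, ?_⟩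
  have hc : ContinuousAt (fun y : ↥Zᶜ ↦ Ψ (f (gradFlow n Z f y t))) x :=
    (h.triple.continuousAt_psi hf (f_gradFlow_mem hf hx ht ht0).2).comp
      (f := fun y : ↥Zᶜ ↦ (gradFlow n Z f y t : M))
      (continuous_subtype_val.continuousAt.comp (continuousAt_gradFlow hf ht))
  filter_upwards [continuous_subtype_val.continuousAt ((h.isOpen_klNhd hf).mem_nhds hx),
    eventually_mem_flowInterval hf ht, hc.eventually (gt_mem_nhds hlt)] with y h1 h2 h3
  exact ⟨h1, h2, h3⟩

theorem IsKLBall.continuousAt_limit (h : IsKLBall n Z f p r ρ Ψ)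
    (hZ : IsRelativeManifold n Z) (hf : IsRelativeFunction n 2 Z f) {x : ↥Zᶜ}
    (hx : (x : M) ∈ klNhd f p r ρ Ψ) {ℓ : ↥Zᶜ → M}
    (hℓ : ∀ᶠ y in 𝓝 x, Tendsto (fun t : flowInterval n Z f y ↦ (gradFlow n Z f y t : M)) atTop
      (𝓝 (ℓ y))) : ContinuousAt ℓ x := by
  refine continuousAt_of_locally_uniform_approx_of_continuousAt fun u hu ↦ ?_
  obtain ⟨ε, hε, hεu⟩ := Metric.mem_uniformity_dist.1 hu
  obtain ⟨t, ht, ht0, hev⟩ := h.exists_eventually_psi_lt hZ hf hx hε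
  refine ⟨_, hev.and hℓ, fun y ↦ (gradFlow n Z f y t : M),
    continuous_subtype_val.continuousAt.comp (continuousAt_gradFlow hf ht), ?_⟩
  rintro y ⟨⟨hy, hty, hlt⟩, hlim⟩
  apply hεu
  rw [dist_comm]
  exact (h.dist_limit_le hZ hf hy hlim hty ht0).trans_lt hlt

variable (n Z) in
/-- The length of the forward trajectory of `-∇ f` starting at `x`. -/
def flowLength (f : M → ℝ) (x : ↥Zᶜ) : ℝ :=
  (∫⁻ t in flowInterval n Z f x ∩ Ici 0,
    ‖grad (n := n) (fun y : ↥Zᶜ ↦ f y) (gradFlow n Z f x t)‖ₑ).toReal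

theorem IsKLBall.lintegral_slope_ne_top (h : IsKLBall n Z f p r ρ Ψ)
    (hZ : IsRelativeManifold n Z) (hf : IsRelativeFunction n 2 Z f) {x : ↥Zᶜ}
    (hx : (x : M) ∈ klNhd f p r ρ Ψ) :
    ∫⁻ t in flowInterval n Z f x ∩ Ici 0,
      ‖grad (n := n) (fun y : ↥Zᶜ ↦ f y) (gradFlow n Z f x t)‖ₑ ≠ ⊤ :=
  ((h.lintegral_slope_tail_le hZ hf hx (hf.isTrajectory x).zero_mem le_rfl).trans_lt
    ENNReal.ofReal_lt_top).ne

/-- The length is at least the distance from `x`, which is not in `Z`, to its limit, which is. -/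
theorem IsKLBall.flowLength_pos (h : IsKLBall n Z f p r ρ Ψ)
    (hZ : IsRelativeManifold n Z) (hf : IsRelativeFunction n 2 Z f) {x : ↥Zᶜ}
    (hx : (x : M) ∈ klNhd f p r ρ Ψ) : 0 < flowLength n Z f x := by
  obtain ⟨q, hqp, hq⟩ := h.exists_tendsto hZ hf hx
  have hqZ := hZ.isClosed.frontier_subset (h.mem_frontier_of_tendsto hf hx hqp hq)
  refine ENNReal.toReal_pos ?_ (h.lintegral_slope_ne_top hZ hf hx)
  refine ((edist_pos.2 ?_).trans_le (edist_limit_le hZ hf hq)).ne'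
  rintro rfl
  exact x.2 hqZ

/-- The difference is the length of the tail after time `t`. -/
theorem IsKLBall.abs_flowLength_sub_le (h : IsKLBall n Z f p r ρ Ψ)
    (hZ : IsRelativeManifold n Z) (hf : IsRelativeFunction n 2 Z f) {x : ↥Zᶜ}
    (hx : (x : M) ∈ klNhd f p r ρ Ψ) {t : ℝ} (ht : t ∈ flowInterval n Z f x) (ht0 : 0 ≤ t) :
    |flowLength n Z f x - ∫ s in (0 : ℝ)..t, slope n Z f (gradFlow n Z f x s)| ≤
      Ψ (f (gradFlow n Z f x t)) := by
  have htr := hf.isTrajectory x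
  have hpsi := h.psi_nonneg hf hx ht ht0
  have hfin := h.lintegral_slope_ne_top hZ hf hx
  have hint : 0 ≤ ∫ s in (0 : ℝ)..t, slope n Z f (gradFlow n Z f x s) :=
    intervalIntegral.integral_nonneg ht0 fun _ _ ↦ norm_nonneg _
  have heq := lintegral_slope_Icc hf htr.zero_mem ht ht0
  have h1 : ENNReal.ofReal (∫ s in (0 : ℝ)..t, slope n Z f (gradFlow n Z f x s)) ≤
      ∫⁻ t in flowInterval n Z f x ∩ Ici 0,
        ‖grad (n := n) (fun y : ↥Zᶜ ↦ f y) (gradFlow n Z f x t)‖ₑ := by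
    rw [← heq]
    exact lintegral_mono_set fun s hs ↦ ⟨htr.ordConnected.out htr.zero_mem ht hs, hs.1⟩
  have h2 : ∫⁻ t in flowInterval n Z f x ∩ Ici 0,
        ‖grad (n := n) (fun y : ↥Zᶜ ↦ f y) (gradFlow n Z f x t)‖ₑ ≤
      ENNReal.ofReal ((∫ s in (0 : ℝ)..t, slope n Z f (gradFlow n Z f x s)) +
        Ψ (f (gradFlow n Z f x t))) := by
    rw [ENNReal.ofReal_add hint hpsi, ← heq]
    refine (lintegral_mono_set (t := Icc 0 t ∪ flowInterval n Z f x ∩ Ici t) ?_).trans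
      ((lintegral_union_le _ _ _).trans
        (add_le_add_right (h.lintegral_slope_tail_le hZ hf hx ht ht0) _))
    rintro s ⟨hs, hs0⟩
    rcases le_total s t with hst | hst
    · exact .inl ⟨hs0, hst⟩
    · exact .inr ⟨hs, hst⟩
  have h1' := (ENNReal.ofReal_le_iff_le_toReal hfin).1 h1
  have h2' := ENNReal.toReal_le_of_le_ofReal (add_nonneg hint hpsi) h2
  rw [abs_le]
  unfold flowLength
  constructor <;> linarith

theorem IsKLBall.continuousAt_flowLength (h : IsKLBall n Z f p r ρ Ψ)
    (hZ : IsRelativeManifold n Z) (hf : IsRelativeFunction n 2 Z f) {x : ↥Zᶜ}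
    (hx : (x : M) ∈ klNhd f p r ρ Ψ) : ContinuousAt (flowLength n Z f) x := by
  refine continuousAt_of_locally_uniform_approx_of_continuousAt fun u hu ↦ ?_
  obtain ⟨ε, hε, hεu⟩ := Metric.mem_uniformity_dist.1 hu
  obtain ⟨t, ht, ht0, hev⟩ := h.exists_eventually_psi_lt hZ hf hx hε
  refine ⟨_, hev, fun y ↦ ∫ s in (0 : ℝ)..t, slope n Z f (gradFlow n Z f y s),
    continuousAt_integral_norm_grad_flow hf.contMDiff ht ht0, ?_⟩
  rintro y ⟨hy, hty, hlt⟩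
  exact hεu ((h.abs_flowLength_sub_le hZ hf hy hty ht0).trans_lt hlt)

/-- Near a point of `Z` the map `R` is approximated by the identity: the displacement of `y` outside
`Z` is at most `Ψ (f y)`, which is small because `Ψ (f x) = 0`. -/
theorem IsKLBall.continuousAt_of_mem (h : IsKLBall n Z f p r ρ Ψ)
    (hZ : IsRelativeManifold n Z) (hf : IsRelativeFunction n 2 Z f) {x : M} (hxZ : x ∈ Z)
    (hx : x ∈ klNhd f p r ρ Ψ) {R : M → M} (hR : ∀ᶠ y in 𝓝 x, y ∈ Z → R y = y)
    (hR' : ∀ᶠ y in 𝓝 x, ∀ hy : y ∈ Zᶜ, Tendsto (fun t : flowInterval n Z f ⟨y, hy⟩ ↦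
      (gradFlow n Z f ⟨y, hy⟩ t : M)) atTop (𝓝 (R y))) : ContinuousAt R x := by
  refine continuousAt_of_locally_uniform_approx_of_continuousAt fun u hu ↦ ?_
  obtain ⟨ε, hε, hεu⟩ := Metric.mem_uniformity_dist.1 hu
  have hlt : Ψ (f x) < ε := by rwa [(hf.eq_zero_iff x).2 hxZ, h.triple.psi_zero]
  refine ⟨_, ((h.isOpen_klNhd hf).eventually_mem hx).and
    (((h.triple.continuousAt_psi hf hx.2.1).eventually (gt_mem_nhds hlt)).and (hR.and hR')), id,
    continuousAt_id, ?_⟩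
  rintro y ⟨hy, hylt, hyR, hyR'⟩
  apply hεu
  by_cases hyZ : y ∈ Z
  · rw [hyR hyZ]
    simpa using hε
  · have htr := hf.isTrajectory ⟨y, hyZ⟩
    have h0 : gradFlow n Z f ⟨y, hyZ⟩ 0 = ⟨y, hyZ⟩ := htr.initial
    have := h.dist_limit_le hZ hf (x := ⟨y, hyZ⟩) hy (hyR' hyZ) htr.zero_mem le_rfl
    rw [h0] at this
    rw [dist_comm]
    exact this.trans_lt hylt

theorem IsMaximalTrajectory.tendsto_iff (hf : IsRelativeFunction n 2 Z f) {x : ↥Zᶜ}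
    {α : ℝ → ↥Zᶜ} {J : Set ℝ}
    (h : IsMaximalTrajectory (n := n) (fun y : ↥Zᶜ ↦ f y) x α J) {q : M} :
    Tendsto (fun t : J ↦ (α t : M)) atTop (𝓝 q) ↔
      Tendsto (fun t : flowInterval n Z f x ↦ (gradFlow n Z f x t : M)) atTop (𝓝 q) := by
  obtain rfl : J = flowInterval n Z f x := h.eq_maxInterval hf.contMDiff
  exact tendsto_congr fun t ↦ by rw [h.eqOn_flow hf.contMDiff t.2]

/-- Points of the interior of `Z` need no Kurdyka–Łojasiewicz ball, since the retraction is the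
identity around them. -/
theorem isGoodNeighborhood_of_forall_klNhd (hZ : IsRelativeManifold n Z)
    (hf : IsRelativeFunction n 2 Z f) {V : Set M} (hV : IsOpen V) (hZV : Z ⊆ V)
    (hK : ∀ x ∈ V, x ∈ interior Z ∨
      ∃ p r ρ Ψ, IsKLBall n Z f p r ρ Ψ ∧ x ∈ klNhd f p r ρ Ψ) :
    IsGoodNeighborhood n Z f V := by
  have hK' : ∀ x : ↥Zᶜ, (x : M) ∈ V →
      ∃ p r ρ Ψ, IsKLBall n Z f p r ρ Ψ ∧ (x : M) ∈ klNhd f p r ρ Ψ := fun x hx ↦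
    (hK x hx).resolve_left fun hint ↦ x.2 (interior_subset hint)
  have hlim : ∀ x : ↥Zᶜ, (x : M) ∈ V → ∃ q ∈ frontier Z,
      Tendsto (fun t : flowInterval n Z f x ↦ (gradFlow n Z f x t : M)) atTop (𝓝 q) := by
    intro x hx
    obtain ⟨p, r, ρ, Ψ, h, hxk⟩ := hK' x hx
    obtain ⟨q, hqp, hq⟩ := h.exists_tendsto hZ hf hxk
    exact ⟨q, h.mem_frontier_of_tendsto hf hxk hqp hq, hq⟩
  -- The limit map is chosen on all of `M`, with the junk value `x` outside `V`, so that continuity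
  -- can be checked pointwise in `M`.
  have hRex : ∀ x : M, ∃ q : M, x ∈ V → q ∈ Z ∧ (x ∈ Z → q = x) ∧
      ∀ hx : x ∈ Zᶜ, Tendsto (fun t : flowInterval n Z f ⟨x, hx⟩ ↦
        (gradFlow n Z f ⟨x, hx⟩ t : M)) atTop (𝓝 q) := by
    intro x
    by_cases hxV : x ∈ V
    · by_cases hxZ : x ∈ Z
      · exact ⟨x, fun _ ↦ ⟨hxZ, fun _ ↦ rfl, fun hx ↦ (hx hxZ).elim⟩⟩
      · obtain ⟨q, hqZ, hq⟩ := hlim ⟨x, hxZ⟩ hxV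
        exact ⟨q, fun _ ↦ ⟨hZ.isClosed.frontier_subset hqZ, fun h ↦ (hxZ h).elim, fun _ ↦ hq⟩⟩
    · exact ⟨x, fun h ↦ (hxV h).elim⟩
  choose R hR using hRex
  have hev : ∀ x ∈ V, ∀ᶠ y in 𝓝 x, y ∈ V := fun x hx ↦ hV.mem_nhds hx
  have hRc : ∀ x ∈ V, ContinuousAt R x := by
    intro x hx
    by_cases hxZ : x ∈ Z
    · rcases hK x hx with hint | ⟨p, r, ρ, Ψ, h, hxk⟩
      · refine continuousAt_id.congr ?_
        filter_upwards [isOpen_interior.mem_nhds hint, hev x hx] with y hy hyV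
        exact ((hR y hyV).2.1 (interior_subset hy)).symm
      · exact h.continuousAt_of_mem hZ hf hxZ hxk ((hev x hx).mono fun y hy ↦ (hR y hy).2.1)
          ((hev x hx).mono fun y hy ↦ (hR y hy).2.2)
    · obtain ⟨p, r, ρ, Ψ, h, hxk⟩ := hK' ⟨x, hxZ⟩ hx
      have hemb := hZ.isClosed.isOpen_compl.isOpenEmbedding_subtypeVal
      refine (hemb.continuousAt_iff (x := ⟨x, hxZ⟩)).1 (h.continuousAt_limit hZ hf hxk ?_)
      filter_upwards [continuous_subtype_val.continuousAt.eventually (hev x hx)] with y hy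
      exact (hR y hy).2.2 y.2
  refine ⟨hV, hZV, ?_, ⟨fun x ↦ ⟨R x, (hR x x.2).1⟩, ?_, fun x hx ↦ (hR x x.2).2.1 hx, ?_⟩,
    ⟨fun x ↦ flowLength n Z f ⟨x, x.2.2⟩, ?_, fun x ↦ ?_⟩⟩
  · intro x hx α J h
    simpa only [h.tendsto_iff hf] using hlim x hx
  · refine Continuous.subtype_mk (continuous_iff_continuousAt.2 fun x ↦ ?_) _
    exact (hRc x x.2).comp continuous_subtype_val.continuousAt
  · intro x hx α J h
    exact (h.tendsto_iff hf).2 ((hR x x.2).2.2 hx)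
  · refine continuous_iff_continuousAt.2 fun x ↦ ?_
    obtain ⟨p, r, ρ, Ψ, h, hxk⟩ := hK' ⟨x, x.2.2⟩ x.2.1
    exact (h.continuousAt_flowLength hZ hf hxk).comp
      (f := fun x : ↥(V ∩ Zᶜ) ↦ (⟨x, x.2.2⟩ : ↥Zᶜ))
      (Continuous.subtype_mk continuous_subtype_val _).continuousAt
  · obtain ⟨p, r, ρ, Ψ, h, hxk⟩ := hK' ⟨x, x.2.2⟩ x.2.1
    refine ⟨h.flowLength_pos hZ hf hxk, fun α J hα ↦ ?_⟩
    rw [hα.forwardLength_eq hf.contMDiff]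
    exact (ENNReal.ofReal_toReal (h.lintegral_slope_ne_top hZ hf hxk)).symm

theorem IsKL.exists_isGoodNeighborhood [LocallyCompactSpace M] (hK : IsKL n Z f)
    (hZ : IsRelativeManifold n Z) (hf : IsRelativeFunction n 2 Z f) {O : Set M} (hO : IsOpen O)
    (hZO : Z ⊆ O) : ∃ V ⊆ O, IsGoodNeighborhood n Z f V := by
  set K : Set M := {x | ∃ p r ρ Ψ, IsKLBall n Z f p r ρ Ψ ∧ x ∈ klNhd f p r ρ Ψ}
  have hKo : IsOpen K := by
    refine isOpen_iff_mem_nhds.2 ?_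
    rintro x ⟨p, r, ρ, Ψ, h, hx⟩
    exact mem_of_superset ((h.isOpen_klNhd hf).mem_nhds hx) fun y hy ↦ ⟨p, r, ρ, Ψ, h, hy⟩
  refine ⟨O ∩ (interior Z ∪ K), inter_subset_left, isGoodNeighborhood_of_forall_klNhd hZ hf
    (hO.inter (isOpen_interior.union hKo)) (fun x hx ↦ ⟨hZO hx, ?_⟩) fun x hx ↦ hx.2⟩
  by_cases hint : x ∈ interior Z
  · exact .inl hint
  · obtain ⟨r, ρ, Ψ, h⟩ := hK.exists_isKLBall (p := x) ⟨subset_closure hx, hint⟩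
    exact .inr ⟨x, r, ρ, Ψ, h, h.self_mem_klNhd hf hx⟩

end Retraction

end KLFlow

end

theorem mainTheorem4 {n : ℕ} {M : Type*} [MetricSpace M] [ConnectedSpace M]
    [LocallyCompactSpace M] {Z : Set M}
    [ChartedSpace (EuclideanSpace ℝ (Fin n)) ↥Zᶜ] [IsManifold (𝓡 n) 2 ↥Zᶜ]
    [RiemannianBundle (fun x : ↥Zᶜ ↦ TangentSpace (𝓡 n) x)]
    [IsContMDiffRiemannianBundle (𝓡 n) 1 (EuclideanSpace ℝ (Fin n))
      (fun x : ↥Zᶜ ↦ TangentSpace (𝓡 n) x)]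
    (hZ : KLFlow.IsRelativeManifold n Z)
    (f : M → ℝ) (hf : KLFlow.IsRelativeFunction n 2 Z f) :
    (∀ x : ↥Zᶜ, ∃ (α : ℝ → ↥Zᶜ) (J : Set ℝ),
      KLFlow.IsMaximalTrajectory (n := n) (fun y : ↥Zᶜ ↦ f y) x α J) ∧
    (∀ (ρ : ℝ) (U : Set M) (Ψ : ℝ → ℝ), KLFlow.IsGlobalKLWith n Z f ρ U Ψ →
      ∃ V ⊆ f ⁻¹' Ico 0 ρ, KLFlow.IsGoodNeighborhood n Z f V) ∧
    (KLFlow.IsKL n Z f → ∃ V : Set M, KLFlow.IsGoodNeighborhood n Z f V) := by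
  refine ⟨fun x ↦ ⟨_, _, KLFlow.isMaximalTrajectory_flow hf.contMDiff x⟩, fun ρ U Ψ h ↦ ?_,
    fun h ↦ ?_⟩
  -- In the global case the extra constraint on `V` is the open set `f < ρ`, which contains `Z`.
  · have hO : IsOpen {x | f x < ρ} := isOpen_lt hf.continuous continuous_const
    obtain ⟨V, hVO, hV⟩ := h.isKL.exists_isGoodNeighborhood hZ hf hO fun x hx ↦ by
      rw [mem_ofPred_eq, (hf.eq_zero_iff x).2 hx]
      exact h.2.rho_pos
    exact ⟨V, fun x hx ↦ ⟨hf.nonneg x, hVO hx⟩, hV⟩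
  · obtain ⟨V, -, hV⟩ := h.exists_isGoodNeighborhood hZ hf isOpen_univ (subset_univ Z)
    exact ⟨V, hV⟩
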